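/- Let $\alpha\in(0,1/2)$ and let $\Pi^+=\{z\in\mathbb C: \Im z>0\}$, $\bar\Pi^+=\{z\in\mathbb C:\Im z\ge 0\}$. For $k\ge 0$ and $z\in\Pi^+$ put $$f_k(z)=2^{\alpha-1}\left[\frac{\alpha(1-2\alpha)(2-2\alpha)_k}{2\cos(\pi\alpha)\,k!}\right]^{1/2}\left[\frac{z+\imath}{2\imath}\right]^{2\alpha-2}\left[\frac{z-\imath}{z+\imath}\right]^k,\qquad (x)_k=\prod_{j=0}^{k-1}(x+j).$$ A $d$-dimensional analytic fractional Brownian motion $\Gamma=(\Gamma(1),\dots,\Gamma(d))$ is obtained from independent standard real Gaussian variables $\xi^1_k(i),\xi^2_k(i)$ ($k\ge0$, $1\le i\le d$): almost surely, for every $i$, $\Gamma(i)$ is the analytic function on $\Pi^+$ that vanishes at the boundary point $0$ and has derivative $\Gamma'_z(i)=\sum_{k\ge0}f_k(z)\xi_k(i)$, where $\xi_k(i)=(\xi^1_k(i)+\imath\,\xi^2_k(i))/\sqrt2$; thus $\mathbf E[\Gamma'_z(i)\overline{\Gamma'_w(i)}]=\frac{\alpha(1-2\alpha)}{2\cos\pi\alpha}(-\imath(z-\bar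 w))^{2\alpha-2}$. For $\varepsilon>0$ let $\Gamma^\varepsilon_z=\Gamma_{z+\imath\varepsilon}$, and for $s,t\in\bar\Pi^+$, $n\ge1$ and $(i_1,\dots,i_n)\in\{1,\dots,d\}^n$ let $$\mathbf\Gamma^{\mathbf n,\varepsilon}_{ts}(i_1,\dots,i_n)=\int_{[s,t]}d\Gamma^\varepsilon_{u_1}(i_1)\int_{[s,u_1]}d\Gamma^\varepsilon_{u_2}(i_2)\cdots\int_{[s,u_{n-1}]}d\Gamma^\varepsilon_{u_n}(i_n),$$ the integrals being taken along straight segments. Let $d\ge 0$, let $\Omega$ be a bounded neighborhood of $0$ in $\bar\Pi^+$, and let $p\ge1$ be real. Then for every $\rho\in(0,2\alpha)$ there is a constant $C_\rho>0$ (depending only on $\alpha,d,\Omega,p,\rho$) such that for every $d$-dimensional analytic fractional Brownian motion $\Gamma$ with parameter $\alpha$, every $n\ge3$, every $(i_1,\dots,i_n)\in\{1,\dots,d\}^n$, all $\varepsilon,\eta>0$ and all $s,t\in\Omega$, the following expectation is finite and $$\mathbf E\left[\left|\mathbf\Gamma^{\mathbf n,\varepsilon}_{ts}(i_1,\dots,i_n)-\mathbf\Gamma^{\mathbf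 n,\eta}_{ts}(i_1,\dots,i_n)\right|^{2p}\right]\le C_\rho\,|\varepsilon-\eta|^{p\rho}\,|t-s|^{p(2n\alpha-\rho)}.$$ -/

import Mathlib

open MeasureTheory ProbabilityTheory Filter Topology

universe u

noncomputable section

/-- The open upper half-plane `Π⁺`. -/
def upperHalf : Set ℂ := {z | 0 < z.im}

/-- The closed upper half-plane. -/
def closedUpperHalf : Set ℂ := {z | 0 ≤ z.im}

/-- The analytic functions
`f_k(z) = 2^(α-1) [α (1-2α) (2-2α)_k / (2 cos(πα) k!)]^(1/2) [(z+i)/(2i)]^(2α-2) [(z-i)/(z+i)]^k`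
on `Π⁺`, where `(x)_k = x (x+1) ⋯ (x+k-1)` and complex powers are principal. -/
def afbmBasis (α : ℝ) (k : ℕ) (z : ℂ) : ℂ :=
  (((2 : ℝ) ^ (α - 1) *
      √(α * (1 - 2 * α) * (∏ j ∈ Finset.range k, (2 - 2 * α + (j : ℝ))) /
        (2 * Real.cos (Real.pi * α) * (k.factorial : ℝ))) : ℝ) : ℂ) *
    ((z + Complex.I) / (2 * Complex.I)) ^ ((2 * α - 2 : ℝ) : ℂ) *
    ((z - Complex.I) / (z + Complex.I)) ^ k

/-- The random series `Γ'_z = ∑ₖ f_k(z) ξ_k`, with `ξ_k = (ξ¹_k + i ξ²_k) / √2`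
(so that `𝐄 |ξ_k|² = 1` when `ξ¹_k`, `ξ²_k` are independent standard Gaussians). -/
def afbmDeriv (α : ℝ) (x y : ℕ → ℝ) (z : ℂ) : ℂ :=
  ∑' k : ℕ, afbmBasis α k z * (((x k : ℂ) + (y k : ℂ) * Complex.I) / ((√2 : ℝ) : ℂ))

/-- `Γ = (Γ(1), …, Γ(d))` is a `d`-dimensional analytic fractional Brownian motion on `Π⁺`:
for independent standard Gaussian variables `ξ (i, k, 0)`, `ξ (i, k, 1)`, almost surely every
component `Γ(i)` is the primitive on `Π⁺` of the series `Γ'(i)` which vanishes at `0`. -/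
def IsAnalyticFBM {𝒰 : Type u} [MeasurableSpace 𝒰] (α : ℝ) {d : ℕ} (P : Measure 𝒰)
    (Γ : Fin d → ℂ → 𝒰 → ℂ) : Prop :=
  ∃ ξ : Fin d × ℕ × Fin 2 → 𝒰 → ℝ,
    (∀ j, Measurable (ξ j)) ∧ (∀ j, P.map (ξ j) = gaussianReal 0 1) ∧ iIndepFun ξ P ∧
    ∀ᵐ ω ∂P, ∀ i : Fin d,
      (∀ z ∈ upperHalf, HasDerivAt (fun w => Γ i w ω)
        (afbmDeriv α (fun k => ξ (i, k, 0) ω) (fun k => ξ (i, k, 1) ω) z) z) ∧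
      Tendsto (fun w => Γ i w ω) (𝓝[upperHalf] 0) (𝓝 0)

/-- The integral `∫_{[s,t]} g(u) du` along the oriented segment from `s` to `t`. -/
def segmentIntegral (s t : ℂ) (g : ℂ → ℂ) : ℂ :=
  ∫ r in (0 : ℝ)..1, (t - s) * g (s + (r : ℂ) * (t - s))

/-- The iterated integral
`∫_{[s,t]} df₁(u₁) ∫_{[s,u₁]} df₂(u₂) ⋯ ∫_{[s,u_{n-1}]} df_n(u_n)` along segments. -/
def iteratedIntegral : (n : ℕ) → (Fin n → ℂ → ℂ) → ℂ → ℂ → ℂ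
  | 0, _, _, _ => 1
  | n + 1, f, s, t =>
      segmentIntegral s t
        (fun u => deriv (f 0) u * iteratedIntegral n (fun j => f j.succ) s u)

/-- `Γ^{n,ε}_{ts}(i₁, …, i_n)`, the iterated integral of the components `i₁, …, i_n` of the
regularized process `Γ^ε_z = Γ_{z + iε}`. -/
def afbmIterated {𝒰 : Type u} {d : ℕ} (Γ : Fin d → ℂ → 𝒰 → ℂ) (ε : ℝ) {n : ℕ}
    (i : Fin n → Fin d) (s t : ℂ) (ω : 𝒰) : ℂ :=
  iteratedIntegral n (fun j z => Γ (i j) (z + (ε : ℂ) * Complex.I) ω) s t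

end

/-!
Uniform `L²ᵖ`-bounds for the iterated integrals of the regularized analytic fractional Brownian
motion.

The forms `dΓ^ε` are holomorphic on a half-plane containing the closed upper half-plane, so their
iterated integrals from `s` to `t` do not depend on the path. The segment `[s, t]`, which may lie on
the real line, where the variance of `Γ'` is infinite, is therefore replaced by an arch `γ` of
height comparable with `τ = |t - s|`. Along the arch the height at parameter `r` is at
least `τ r (1 - r)`, and the covariance of `Γ'`, summed in closed form by the binomial series
(`hasSum_afbmBasis_mul_conj`), gives the standard deviations

* of `Γ'` at height `y`: of order `y ^ (α - 1)`;
* of `Γ'_{z+iε} - Γ'_{z+iη}`: of order `|ε - η| ^ (ρ/2) y ^ (α - 1 - ρ/2)`.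

Both are integrable along `γ` since `ρ < 2 α`. If `a` and `b` denote the integrals along `γ` of the
moduli of the forms and of the moduli of their differences, the difference of the two iterated
integrals of order `n` is at most `b a ^ (n-1) / (n-1)!` (`norm_iteratedFormIntegral_sub_le`). In the
natural units `q = τ ^ α` for `a` and `q' = |ε - η| ^ (ρ/2) τ ^ (α - ρ/2)` for `b` this is at most
`q' q ^ (n-1) exp (a / q + b / q')`, which produces the right power of `|ε - η|` and of `τ` and no
dependence of the constant on `n`. Finally `E exp (2 p (a / q + b / q'))` is bounded by a constant
that depends on `α`, `d`, `p`, `ρ` only: Jensen's inequality along the arch (`ofReal_exp_integral_le`) reduces it to exponential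
moments of `|Γ'_z|` and `|Γ'_{z+iε} - Γ'_{z+iη}|` at a single point, which are Gaussian
(`lintegral_exp_norm_tsum_complexGaussian_le`).
-/

/-! ### Iterated integrals of holomorphic forms -/

/-- The iterated integral `∫_{[s,t]} g₁(u₁) du₁ ∫_{[s,u₁]} g₂(u₂) du₂ ⋯` of the one-forms
`g_j(u) du` along segments. -/
noncomputable def iteratedFormIntegral : (n : ℕ) → (Fin n → ℂ → ℂ) → ℂ → ℂ → ℂ
  | 0, _, _, _ => 1
  | n + 1, g, s, t =>
      segmentIntegral s t (fun u => g 0 u * iteratedFormIntegral n (fun j => g j.succ) s u)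

lemma segment_point_mem {U : Set ℂ} (hU : Convex ℝ U) {s t : ℂ} (hs : s ∈ U) (ht : t ∈ U)
    {r : ℝ} (hr : r ∈ Set.Icc (0 : ℝ) 1) : s + (r : ℂ) * (t - s) ∈ U := by
  have := hU.add_smul_sub_mem hs ht hr
  simpa using this

lemma segmentIntegral_congr {U : Set ℂ} (hU : Convex ℝ U) {s t : ℂ} (hs : s ∈ U) (ht : t ∈ U)
    {F G : ℂ → ℂ} (h : Set.EqOn F G U) : segmentIntegral s t F = segmentIntegral s t G := by
  unfold segmentIntegral
  refine intervalIntegral.integral_congr fun r hr => ?_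
  rw [Set.uIcc_of_le zero_le_one] at hr
  simp only [h (segment_point_mem hU hs ht hr)]

lemma iteratedIntegral_eq_iteratedFormIntegral {U : Set ℂ} (hU : Convex ℝ U) {s : ℂ}
    (hs : s ∈ U) : ∀ (n : ℕ) (f g : Fin n → ℂ → ℂ), (∀ j, Set.EqOn (deriv (f j)) (g j) U) →
      ∀ t ∈ U, iteratedIntegral n f s t = iteratedFormIntegral n g s t
  | 0, _, _, _, _, _ => rfl
  | n + 1, f, g, h, t, ht => by
    refine segmentIntegral_congr hU hs ht fun u hu => ?_
    have := iteratedIntegral_eq_iteratedFormIntegral hU hs n (fun j => f j.succ)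
      (fun j => g j.succ) (fun j => h j.succ) u hu
    simp only [h 0 hu, this]

lemma iteratedFormIntegral_self {n : ℕ} (hn : n ≠ 0) (g : Fin n → ℂ → ℂ) (s : ℂ) :
    iteratedFormIntegral n g s s = 0 := by
  obtain ⟨m, rfl⟩ := Nat.exists_eq_succ_of_ne_zero hn
  simp [iteratedFormIntegral, segmentIntegral]

lemma segmentIntegral_eq_sub {U : Set ℂ} (hU : Convex ℝ U) {s t : ℂ} (hs : s ∈ U) (ht : t ∈ U)
    {F G : ℂ → ℂ} (hF : ContinuousOn F U) (hG : ∀ z ∈ U, HasDerivWithinAt G (F z) U z) :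
    segmentIntegral s t F = G t - G s := by
  have hmaps : Set.MapsTo (fun r : ℝ => s + (r : ℂ) * (t - s)) (Set.Icc 0 1) U :=
    fun r hr => segment_point_mem hU hs ht hr
  have hline : ∀ r : ℝ, HasDerivAt (fun r : ℝ => s + (r : ℂ) * (t - s)) (t - s) r := fun r => by
    simpa using ((Complex.ofRealCLM.hasDerivAt (x := r)).mul_const (t - s)).const_add s
  have hlc : Continuous (fun r : ℝ => s + (r : ℂ) * (t - s)) := by fun_prop
  have hder : ∀ r ∈ Set.Icc (0 : ℝ) 1, HasDerivWithinAt (fun r : ℝ => G (s + (r : ℂ) * (t - s)))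
      ((t - s) * F (s + (r : ℂ) * (t - s))) (Set.Icc 0 1) r := fun r hr => by
    simpa [Function.comp_def] using
      (hG _ (hmaps hr)).scomp r (hline r).hasDerivWithinAt hmaps
  have hcont : ContinuousOn (fun r : ℝ => (t - s) * F (s + (r : ℂ) * (t - s))) (Set.Icc 0 1) :=
    continuousOn_const.mul (hF.comp hlc.continuousOn hmaps)
  have := intervalIntegral.integral_eq_sub_of_hasDerivAt_of_le zero_le_one
    (fun r hr => (hder r hr).continuousWithinAt)
    (fun r hr => (hder r (Set.Ioo_subset_Icc_self hr)).hasDerivAt (Icc_mem_nhds hr.1 hr.2))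
    (hcont.intervalIntegrable_of_Icc zero_le_one)
  simpa [segmentIntegral] using this

/-- On a convex open set a holomorphic function has a primitive, so its segment integral is
itself a primitive in the endpoint. -/
lemma hasDerivAt_segmentIntegral {U : Set ℂ} (hU : Convex ℝ U) (hUo : IsOpen U) {s t : ℂ}
    (hs : s ∈ U) (ht : t ∈ U) {F : ℂ → ℂ} (hF : DifferentiableOn ℂ F U) :
    HasDerivAt (fun t => segmentIntegral s t F) (F t) t := by
  obtain ⟨G, hG⟩ := hU.exists_forall_hasDerivWithinAt hF
  have h1 : HasDerivAt (fun t => G t - G s) (F t) t :=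
    ((hG t ht).hasDerivAt (hUo.mem_nhds ht)).sub_const _
  refine h1.congr_of_eventuallyEq ?_
  filter_upwards [hUo.mem_nhds ht] with z hz
  exact segmentIntegral_eq_sub hU hs hz hF.continuousOn hG

lemma differentiableOn_iteratedFormIntegral {U : Set ℂ} (hU : Convex ℝ U) (hUo : IsOpen U)
    {s : ℂ} (hs : s ∈ U) : ∀ (n : ℕ) (g : Fin n → ℂ → ℂ),
      (∀ j, DifferentiableOn ℂ (g j) U) → DifferentiableOn ℂ (iteratedFormIntegral n g s) U
  | 0, _, _ => differentiableOn_const 1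
  | n + 1, g, hg => fun _ ht =>
    (hasDerivAt_segmentIntegral hU hUo hs ht ((hg 0).mul
      (differentiableOn_iteratedFormIntegral hU hUo hs n (fun j => g j.succ)
        fun j => hg j.succ))).differentiableAt.differentiableWithinAt

lemma hasDerivAt_iteratedFormIntegral {U : Set ℂ} (hU : Convex ℝ U) (hUo : IsOpen U)
    {s t : ℂ} (hs : s ∈ U) (ht : t ∈ U) {n : ℕ} {g : Fin (n + 1) → ℂ → ℂ}
    (hg : ∀ j, DifferentiableOn ℂ (g j) U) :
    HasDerivAt (iteratedFormIntegral (n + 1) g s)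
      (g 0 t * iteratedFormIntegral n (fun j => g j.succ) s t) t :=
  hasDerivAt_segmentIntegral hU hUo hs ht ((hg 0).mul
    (differentiableOn_iteratedFormIntegral hU hUo hs n _ fun j => hg j.succ))

section PathBounds

variable {U : Set ℂ} (hU : Convex ℝ U) (hUo : IsOpen U) {γ γ' : ℝ → ℂ}
  (hγU : ∀ r ∈ Set.Icc (0 : ℝ) 1, γ r ∈ U) (hγ : ∀ r, HasDerivAt γ (γ' r) r)
  {φ ψ : ℝ → ℝ} (hφ : Continuous φ) (hφ0 : ∀ r, 0 ≤ φ r) (hψ : Continuous ψ)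

lemma hasDerivAt_pow_div_factorial {a : ℝ → ℝ} {a' r : ℝ} (ha : HasDerivAt a a' r) (n : ℕ) :
    HasDerivAt (fun r => a r ^ (n + 1) / (n + 1).factorial) (a' * (a r ^ n / n.factorial)) r := by
  have := (ha.pow (n + 1)).div_const ((n + 1).factorial : ℝ)
  convert! this using 1
  have h1 : ((n : ℝ) + 1) ≠ 0 := by positivity
  have h2 : (n.factorial : ℝ) ≠ 0 := by positivity
  rw [Nat.factorial_succ]
  push_cast
  field_simp

include hU hUo hγU hγ hφ hφ0 in
/-- Iterated integrals of holomorphic forms do not see the path, so they can be estimated along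
any path `γ` issued from `s`; the simplex supplies the factorial. -/
lemma norm_iteratedFormIntegral_le : ∀ (n : ℕ) (g : Fin n → ℂ → ℂ),
    (∀ j, DifferentiableOn ℂ (g j) U) →
    (∀ j, ∀ r ∈ Set.Icc (0 : ℝ) 1, ‖γ' r‖ * ‖g j (γ r)‖ ≤ φ r) → ∀ r ∈ Set.Icc (0 : ℝ) 1,
      ‖iteratedFormIntegral n g (γ 0) (γ r)‖ ≤ (∫ x in (0 : ℝ)..r, φ x) ^ n / n.factorial
  | 0, _, _, _, r, _ => by simp [iteratedFormIntegral]
  | n + 1, g, hg, hb, r, hr => by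
    have h0 : (0 : ℝ) ∈ Set.Icc (0 : ℝ) 1 := by simp
    have hder : ∀ r ∈ Set.Icc (0 : ℝ) 1,
        HasDerivAt (fun r => iteratedFormIntegral (n + 1) g (γ 0) (γ r))
          (γ' r * (g 0 (γ r) * iteratedFormIntegral n (fun j => g j.succ) (γ 0) (γ r))) r :=
      fun r hr => (hasDerivAt_iteratedFormIntegral hU hUo (hγU 0 h0) (hγU r hr) hg).scomp r (hγ r)
    refine image_norm_le_of_norm_deriv_right_le_deriv_boundary
      (fun r hr => (hder r hr).continuousAt.continuousWithinAt)
      (fun r hr => (hder r (Set.Ico_subset_Icc_self hr)).hasDerivWithinAt)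
      (B := fun r => (∫ x in (0 : ℝ)..r, φ x) ^ (n + 1) / (n + 1).factorial) ?_
      (fun r => hasDerivAt_pow_div_factorial (hφ.integral_hasStrictDerivAt 0 r).hasDerivAt n)
      (fun r hr => ?_) hr
    · simp [iteratedFormIntegral_self]
    · have hr' := Set.Ico_subset_Icc_self hr
      have ih := norm_iteratedFormIntegral_le n (fun j => g j.succ) (fun j => hg j.succ)
        (fun j => hb j.succ) r hr'
      rw [norm_mul, norm_mul, ← mul_assoc]
      exact mul_le_mul (hb 0 r hr') ih (norm_nonneg _) (hφ0 r)

include hU hUo hγU hγ hφ hφ0 hψ in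
/-- Changing the forms one at a time: with `a = ∫ φ` and `b = ∫ ψ` the function `b aⁿ / n!` solves
the differential inequality obtained from the product rule. -/
lemma norm_iteratedFormIntegral_sub_le : ∀ (n : ℕ) (g h : Fin (n + 1) → ℂ → ℂ),
    (∀ j, DifferentiableOn ℂ (g j) U) → (∀ j, DifferentiableOn ℂ (h j) U) →
    (∀ j, ∀ r ∈ Set.Icc (0 : ℝ) 1, ‖γ' r‖ * ‖g j (γ r)‖ ≤ φ r) →
    (∀ j, ∀ r ∈ Set.Icc (0 : ℝ) 1, ‖γ' r‖ * ‖h j (γ r)‖ ≤ φ r) →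
    (∀ j, ∀ r ∈ Set.Icc (0 : ℝ) 1, ‖γ' r‖ * ‖g j (γ r) - h j (γ r)‖ ≤ ψ r) →
    ∀ r ∈ Set.Icc (0 : ℝ) 1,
      ‖iteratedFormIntegral (n + 1) g (γ 0) (γ r) - iteratedFormIntegral (n + 1) h (γ 0) (γ r)‖ ≤
        (∫ x in (0 : ℝ)..r, ψ x) * ((∫ x in (0 : ℝ)..r, φ x) ^ n / n.factorial) := by
  have h0 : (0 : ℝ) ∈ Set.Icc (0 : ℝ) 1 := by simp
  have hder : ∀ (n : ℕ) (g : Fin (n + 1) → ℂ → ℂ), (∀ j, DifferentiableOn ℂ (g j) U) →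
      ∀ r ∈ Set.Icc (0 : ℝ) 1,
      HasDerivAt (fun r => iteratedFormIntegral (n + 1) g (γ 0) (γ r))
        (γ' r * (g 0 (γ r) * iteratedFormIntegral n (fun j => g j.succ) (γ 0) (γ r))) r :=
    fun n g hg r hr =>
      (hasDerivAt_iteratedFormIntegral hU hUo (hγU 0 h0) (hγU r hr) hg).scomp r (hγ r)
  have hA : ∀ r, HasDerivAt (fun r => ∫ x in (0 : ℝ)..r, φ x) (φ r) r :=
    fun r => (hφ.integral_hasStrictDerivAt 0 r).hasDerivAt
  have hB : ∀ r, HasDerivAt (fun r => ∫ x in (0 : ℝ)..r, ψ x) (ψ r) r :=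
    fun r => (hψ.integral_hasStrictDerivAt 0 r).hasDerivAt
  intro n
  induction n with
  | zero =>
    intro g h hg hh _ _ hbd r hr
    have hd := fun r hr => (hder 0 g hg r hr).sub (hder 0 h hh r hr)
    refine image_norm_le_of_norm_deriv_right_le_deriv_boundary
      (fun r hr => (hd r hr).continuousAt.continuousWithinAt)
      (fun r hr => (hd r (Set.Ico_subset_Icc_self hr)).hasDerivWithinAt)
      (B := fun r => (∫ x in (0 : ℝ)..r, ψ x) *
        ((∫ x in (0 : ℝ)..r, φ x) ^ 0 / (0 : ℕ).factorial)) ?_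
      (B' := ψ) (fun r => by simpa using hB r) (fun r hr => ?_) hr
    · simp [iteratedFormIntegral_self]
    · have := hbd 0 r (Set.Ico_subset_Icc_self hr)
      simpa [iteratedFormIntegral, ← mul_sub] using this
  | succ n ih =>
    intro g h hg hh hbg hbh hbd r hr
    have hd := fun r hr => (hder (n + 1) g hg r hr).sub (hder (n + 1) h hh r hr)
    refine image_norm_le_of_norm_deriv_right_le_deriv_boundary
      (fun r hr => (hd r hr).continuousAt.continuousWithinAt)
      (fun r hr => (hd r (Set.Ico_subset_Icc_self hr)).hasDerivWithinAt)
      (B := fun r => (∫ x in (0 : ℝ)..r, ψ x) *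
        ((∫ x in (0 : ℝ)..r, φ x) ^ (n + 1) / (n + 1).factorial)) ?_
      (fun r => (hB r).mul (hasDerivAt_pow_div_factorial (hA r) n)) (fun r hr => ?_) hr
    · simp [iteratedFormIntegral_self]
    · have hr' := Set.Ico_subset_Icc_self hr
      have i1 := ih (fun j => g j.succ) (fun j => h j.succ) (fun j => hg j.succ)
        (fun j => hh j.succ) (fun j => hbg j.succ) (fun j => hbh j.succ)
        (fun j => hbd j.succ) r hr'
      have i2 := norm_iteratedFormIntegral_le hU hUo hγU hγ hφ hφ0 (n + 1) (fun j => g j.succ)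
        (fun j => hg j.succ) (fun j => hbg j.succ) r hr'
      set X := iteratedFormIntegral (n + 1) (fun j => g j.succ) (γ 0) (γ r)
      set Y := iteratedFormIntegral (n + 1) (fun j => h j.succ) (γ 0) (γ r)
      have e : γ' r * (g 0 (γ r) * X) - γ' r * (h 0 (γ r) * Y) =
          γ' r * (g 0 (γ r) - h 0 (γ r)) * X + γ' r * h 0 (γ r) * (X - Y) := by ring
      have j1 : ‖γ' r * (g 0 (γ r) - h 0 (γ r))‖ ≤ ψ r := by
        rw [norm_mul]; exact hbd 0 r hr'
      have j2 : ‖γ' r * h 0 (γ r)‖ ≤ φ r := by rw [norm_mul]; exact hbh 0 r hr'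
      rw [e]
      refine (norm_add_le _ _).trans (add_le_add ?_ ?_)
      · rw [norm_mul]
        exact mul_le_mul j1 i2 (norm_nonneg _) ((norm_nonneg _).trans j1)
      · rw [norm_mul, mul_left_comm]
        exact mul_le_mul j2 i1 (norm_nonneg _) (hφ0 r)

end PathBounds

/-! ### The covariance kernel -/

lemma prod_add_div_factorial_eq_choose (b : ℂ) (k : ℕ) :
    (∏ j ∈ Finset.range k, (b + (j : ℂ))) / (k.factorial : ℂ) = Ring.choose (b + k - 1) k := by
  have h : ∀ k : ℕ, (ascPochhammer ℂ k).eval b = ∏ j ∈ Finset.range k, (b + (j : ℂ)) := by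
    intro k
    induction k with
    | zero => simp
    | succ k ih => rw [ascPochhammer_succ_eval, ih, Finset.prod_range_succ]
  have h2 := Ring.factorial_nsmul_multichoose_eq_ascPochhammer b k
  rw [Polynomial.ascPochhammer_smeval_eq_eval, h, nsmul_eq_mul] at h2
  have h3 : (k.factorial : ℂ) ≠ 0 := by exact_mod_cast k.factorial_ne_zero
  rw [← h2, mul_div_cancel_left₀ _ h3, Ring.choose]
  congr 1
  ring

lemma hasSum_prod_add_mul_pow (b : ℝ) {ζ : ℂ} (hζ : ‖ζ‖ < 1) :
    HasSum (fun k : ℕ => (((∏ j ∈ Finset.range k, (b + (j : ℝ))) / (k.factorial : ℝ) : ℝ) : ℂ) *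
      ζ ^ k) ((1 - ζ) ^ (-b : ℂ)) := by
  have h := (Complex.one_div_one_sub_cpow_hasFPowerSeriesOnBall_zero (b : ℂ)).hasSum
    (y := ζ) (by rw [Metric.mem_eball, edist_zero_right, ← ofReal_norm, ENNReal.ofReal_lt_one]; exact hζ)
  convert! h using 1
  · funext k
    simp [← prod_add_div_factorial_eq_choose, mul_comm]
  · rw [zero_add, Complex.cpow_neg, one_div]

lemma Complex.mul_cpow_of_re_pos {a b : ℂ} (ha : 0 < a.re) (hb : 0 < b.re) (s : ℂ) :
    (a * b) ^ s = a ^ s * b ^ s := by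
  have ha0 : a ≠ 0 := by rintro rfl; simp at ha
  have hb0 : b ≠ 0 := by rintro rfl; simp at hb
  have h1 := abs_lt.1 (Complex.abs_arg_lt_pi_div_two_iff.2 (Or.inl ha))
  have h2 := abs_lt.1 (Complex.abs_arg_lt_pi_div_two_iff.2 (Or.inl hb))
  rw [Complex.cpow_def_of_ne_zero ha0, Complex.cpow_def_of_ne_zero hb0,
    Complex.cpow_def_of_ne_zero (mul_ne_zero ha0 hb0),
    Complex.log_mul ha0 hb0 ⟨by linarith, by linarith⟩, add_mul, Complex.exp_add]

lemma Complex.arg_ne_pi_of_re_pos {a : ℂ} (ha : 0 < a.re) : a.arg ≠ Real.pi := by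
  have h1 := abs_lt.1 (Complex.abs_arg_lt_pi_div_two_iff.2 (Or.inl ha))
  have := Real.pi_pos
  intro h
  linarith

/-- Principal powers are multiplicative on three factors of positive real part whose product has
positive real part too: the arguments cannot wind. -/
lemma Complex.mul_mul_cpow_of_re_pos {a b c : ℂ} (ha : 0 < a.re) (hb : 0 < b.re) (hc : 0 < c.re)
    (habc : 0 < (a * b * c).re) (s : ℂ) : (a * b * c) ^ s = a ^ s * b ^ s * c ^ s := by
  have hc0 : c ≠ 0 := by rintro rfl; simp at hc
  have hci : 0 < (c⁻¹).re := by
    rw [Complex.inv_re]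
    exact div_pos hc (Complex.normSq_pos.2 hc0)
  have h := Complex.mul_cpow_of_re_pos habc hci s
  rw [mul_assoc (a * b), mul_inv_cancel₀ hc0, mul_one, Complex.mul_cpow_of_re_pos ha hb,
    Complex.inv_cpow _ _ (Complex.arg_ne_pi_of_re_pos hc)] at h
  rw [h, mul_assoc ((a * b * c) ^ s), inv_mul_cancel₀ (by simp [Complex.cpow_eq_zero_iff, hc0]), mul_one]

/-- The constant `4^(α-1) α (1-2α) / (2 cos πα)` in front of the covariance of `Γ'`. -/
noncomputable def afbmConst (α : ℝ) : ℝ :=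
  ((2 : ℝ) ^ (α - 1)) ^ 2 * (α * (1 - 2 * α) / (2 * Real.cos (Real.pi * α)))

lemma afbmConst_pos {α : ℝ} (hα : 0 < α) (hα' : α < 1 / 2) : 0 < afbmConst α := by
  have hc : 0 < Real.cos (Real.pi * α) := by
    apply Real.cos_pos_of_mem_Ioo
    constructor <;> nlinarith [Real.pi_pos]
  have : 0 < 1 - 2 * α := by linarith
  unfold afbmConst
  positivity

lemma norm_cayley_lt_one {z : ℂ} (hz : 0 < z.im) :
    ‖(z - Complex.I) / (z + Complex.I)‖ < 1 := by
  have h0 : z + Complex.I ≠ 0 := by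
    intro h
    have := congrArg Complex.im h
    simp at this
    linarith
  rw [norm_div, div_lt_one (norm_pos_iff.2 h0), ← sq_lt_sq₀ (norm_nonneg _) (norm_nonneg _),
    ← Complex.normSq_eq_norm_sq, ← Complex.normSq_eq_norm_sq, Complex.normSq_apply,
    Complex.normSq_apply]
  simp
  nlinarith

section Kernel

variable {α : ℝ} (hα : 0 < α) (hα' : α < 1 / 2)

/-- The covariance of `Γ'`: `∑ₖ f_k(z) conj (f_k(w))` in closed form. -/
noncomputable def afbmCov (α : ℝ) (z w : ℂ) : ℂ :=
  (afbmConst α : ℂ) *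
    (-Complex.I * (z - (starRingEnd ℂ) w) / 2) ^ ((2 * α - 2 : ℝ) : ℂ)

/-- The coefficient in front of the `k`-th basis function. -/
noncomputable def afbmCoeff (α : ℝ) (k : ℕ) : ℝ :=
  (2 : ℝ) ^ (α - 1) *
      √(α * (1 - 2 * α) * (∏ j ∈ Finset.range k, (2 - 2 * α + (j : ℝ))) /
        (2 * Real.cos (Real.pi * α) * (k.factorial : ℝ)))

include hα hα' in
lemma afbmCoeff_sq (k : ℕ) : afbmCoeff α k ^ 2 =
    afbmConst α * ((∏ j ∈ Finset.range k, (2 - 2 * α + (j : ℝ))) / (k.factorial : ℝ)) := by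
  have hc : 0 < Real.cos (Real.pi * α) := by
    apply Real.cos_pos_of_mem_Ioo
    constructor <;> nlinarith [Real.pi_pos]
  have h1 : 0 < 1 - 2 * α := by linarith
  have hp : 0 ≤ ∏ j ∈ Finset.range k, (2 - 2 * α + (j : ℝ)) :=
    Finset.prod_nonneg fun j _ => by have : (0 : ℝ) ≤ j := j.cast_nonneg; linarith
  rw [afbmCoeff, mul_pow, Real.sq_sqrt (by positivity), afbmConst]
  have : (k.factorial : ℝ) ≠ 0 := by positivity
  field_simp

include hα hα' in
lemma hasSum_afbmBasis_mul_conj {z w : ℂ} (hz : 0 < z.im) (hw : 0 < w.im) :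
    HasSum (fun k => afbmBasis α k z * (starRingEnd ℂ) (afbmBasis α k w)) (afbmCov α z w) := by
  set A := (z - Complex.I) / (z + Complex.I) with hA
  set B := (w - Complex.I) / (w + Complex.I) with hB
  set a := (z + Complex.I) / (2 * Complex.I) with ha
  set b := (w + Complex.I) / (2 * Complex.I) with hb
  set s : ℂ := ((2 * α - 2 : ℝ) : ℂ) with hs
  have hA1 : ‖A‖ < 1 := norm_cayley_lt_one hz
  have hB1 : ‖B‖ < 1 := norm_cayley_lt_one hw
  have hAB : ‖A * (starRingEnd ℂ) B‖ < 1 := by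
    rw [norm_mul, RCLike.norm_conj]
    exact mul_lt_one_of_nonneg_of_lt_one_left (norm_nonneg _) hA1 hB1.le
  have hare : ∀ z : ℂ, 0 < z.im → 0 < ((z + Complex.I) / (2 * Complex.I)).re := by
    intro z hz
    have : (z + Complex.I) / (2 * Complex.I) = -Complex.I * (z + Complex.I) / 2 := by
      have := Complex.I_ne_zero
      field_simp
      linear_combination (z + Complex.I) * Complex.I_sq
    rw [this]
    have : (-Complex.I * (z + Complex.I) / 2).re = (z.im + 1) / 2 := by simp
    rw [this]
    linarith
  have hbre : 0 < ((starRingEnd ℂ) b).re := by simpa using hare w hw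
  have hcre : 0 < (1 - A * (starRingEnd ℂ) B).re := by
    have := (abs_le.1 (Complex.abs_re_le_norm (A * (starRingEnd ℂ) B))).2
    rw [Complex.sub_re, Complex.one_re]
    linarith
  have hz0 : z + Complex.I ≠ 0 := by
    intro h; have := congrArg Complex.im h; simp at this; linarith
  have hw0 : (starRingEnd ℂ) w - Complex.I ≠ 0 := by
    intro h; have := congrArg Complex.im h; simp at this; linarith
  have hprod : a * (starRingEnd ℂ) b * (1 - A * (starRingEnd ℂ) B) =
      -Complex.I * (z - (starRingEnd ℂ) w) / 2 := by
    simp only [ha, hb, hA, hB, map_div₀, map_add, map_sub, map_mul, Complex.conj_I, map_ofNat]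
    have := Complex.I_ne_zero
    have hw1 : (starRingEnd ℂ) w + -Complex.I ≠ 0 := by simpa [sub_eq_add_neg] using hw0
    field_simp
    ring_nf
    simp only [show Complex.I ^ 3 = -Complex.I by rw [pow_succ, Complex.I_sq]; ring]
    ring
  have hpre : 0 < (a * (starRingEnd ℂ) b * (1 - A * (starRingEnd ℂ) B)).re := by
    rw [hprod]
    have : (-Complex.I * (z - (starRingEnd ℂ) w) / 2).re = (z.im + w.im) / 2 := by simp
    rw [this]
    linarith
  have hsum := (hasSum_prod_add_mul_pow (2 - 2 * α) hAB).mul_left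
    ((afbmConst α : ℂ) * (a ^ s * ((starRingEnd ℂ) b) ^ s))
  have hexp : (-((2 - 2 * α : ℝ) : ℂ)) = s := by rw [hs]; push_cast; ring
  rw [hexp] at hsum
  convert! hsum using 1
  · funext k
    have hconj : (starRingEnd ℂ) (b ^ s) = ((starRingEnd ℂ) b) ^ s := by
      rw [Complex.conj_cpow _ _ (Complex.arg_ne_pi_of_re_pos (hare w hw)), hs, Complex.conj_ofReal]
    have hz' : afbmBasis α k z = (afbmCoeff α k : ℂ) * a ^ s * A ^ k := rfl
    have hw' : afbmBasis α k w = (afbmCoeff α k : ℂ) * b ^ s * B ^ k := rfl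
    have hsq : (afbmCoeff α k : ℂ) ^ 2 = (afbmConst α : ℂ) *
        (((∏ j ∈ Finset.range k, (2 - 2 * α + (j : ℝ))) / (k.factorial : ℝ) : ℝ) : ℂ) := by
      exact_mod_cast congrArg (fun x : ℝ => (x : ℂ)) (afbmCoeff_sq hα hα' k)
    rw [hz', hw', map_mul, map_mul, map_pow, Complex.conj_ofReal, hconj, mul_pow]
    linear_combination (a ^ s * ((starRingEnd ℂ) b) ^ s * A ^ k * ((starRingEnd ℂ) B) ^ k) * hsq
  · unfold afbmCov
    rw [← hprod, Complex.mul_mul_cpow_of_re_pos (hare z hz) hbre hcre hpre]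
    ring

lemma afbmCov_vertical {z : ℂ} {a b : ℝ} (h : 0 ≤ 2 * z.im + a + b) :
    afbmCov α (z + a * Complex.I) (z + b * Complex.I) =
      ((afbmConst α * (z.im + (a + b) / 2) ^ (2 * α - 2) : ℝ) : ℂ) := by
  have : -Complex.I * ((z + a * Complex.I) - (starRingEnd ℂ) (z + b * Complex.I)) / 2 =
      ((z.im + (a + b) / 2 : ℝ) : ℂ) := by
    apply Complex.ext <;> simp
    ring
  rw [afbmCov, this, Complex.ofReal_mul, Complex.ofReal_cpow (by linarith)]

include hα hα' in
lemma hasSum_norm_sq_afbmBasis {z : ℂ} (hz : 0 < z.im) :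
    HasSum (fun k => ‖afbmBasis α k z‖ ^ 2) (afbmConst α * z.im ^ (2 * α - 2)) := by
  have h := hasSum_afbmBasis_mul_conj hα hα' hz hz
  have h2 := afbmCov_vertical (α := α) (z := z) (a := 0) (b := 0) (by linarith)
  simp only [Complex.ofReal_zero, zero_mul, add_zero, zero_div] at h2
  rw [h2] at h
  rw [← Complex.hasSum_ofReal]
  convert! h using 2 with k
  rw [Complex.mul_conj, Complex.normSq_eq_norm_sq]

include hα hα' in
/-- The variance of a vertical increment of `Γ'`; on a vertical line the covariance is real. -/
lemma hasSum_norm_sq_afbmBasis_sub {z : ℂ} {a b : ℝ} (ha : 0 < z.im + a) (hb : 0 < z.im + b) :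
    HasSum (fun k => ‖afbmBasis α k (z + a * Complex.I) - afbmBasis α k (z + b * Complex.I)‖ ^ 2)
      (afbmConst α * ((z.im + a) ^ (2 * α - 2) + (z.im + b) ^ (2 * α - 2) -
        2 * (z.im + (a + b) / 2) ^ (2 * α - 2))) := by
  have ha' : 0 < (z + a * Complex.I).im := by simpa using ha
  have hb' : 0 < (z + b * Complex.I).im := by simpa using hb
  have haa := hasSum_norm_sq_afbmBasis hα hα' ha'
  have hbb := hasSum_norm_sq_afbmBasis hα hα' hb'
  have hab := hasSum_afbmBasis_mul_conj hα hα' ha' hb'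
  rw [afbmCov_vertical (by linarith)] at hab
  have hre := (Complex.hasSum_re hab).mul_left 2
  have := (haa.add hbb).sub hre
  convert! this using 1
  · funext k
    rw [← Complex.normSq_eq_norm_sq, Complex.normSq_sub, Complex.normSq_eq_norm_sq,
      Complex.normSq_eq_norm_sq]
  · simp
    ring

include hα hα' in
/-- Absolute summability, from `√aₖ ≤ aₖ + 1` and the geometric factor `|(z - i) / (z + i)|ᵏ`. -/
lemma summable_norm_afbmBasis {z : ℂ} (hz : 0 < z.im) :
    Summable (fun k => ‖afbmBasis α k z‖) := by
  set A := (z - Complex.I) / (z + Complex.I) with hA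
  have hA1 : ‖A‖ < 1 := norm_cayley_lt_one hz
  set a := (z + Complex.I) / (2 * Complex.I)
  have h1 : ‖((‖A‖ : ℝ) : ℂ)‖ < 1 := by simpa using hA1
  have hs := (hasSum_prod_add_mul_pow (2 - 2 * α) h1).summable
  have hs' : Summable (fun k => afbmCoeff α k ^ 2 * ‖A‖ ^ k) := by
    have h2 : Summable (fun k : ℕ => ((∏ j ∈ Finset.range k, (2 - 2 * α + (j : ℝ))) /
        (k.factorial : ℝ)) * ‖A‖ ^ k) := by
      rw [← Complex.summable_ofReal]
      simpa using hs
    refine (h2.mul_left (afbmConst α)).congr fun k => ?_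
    rw [afbmCoeff_sq hα hα']
    ring
  have hg : Summable (fun k => ‖A‖ ^ k) := summable_geometric_of_lt_one (norm_nonneg _) hA1
  refine Summable.of_nonneg_of_le (fun _ => norm_nonneg _) (fun k => ?_)
    ((hs'.add hg).mul_left ‖a ^ ((2 * α - 2 : ℝ) : ℂ)‖)
  have hz' : afbmBasis α k z =
    (afbmCoeff α k : ℂ) * a ^ ((2 * α - 2 : ℝ) : ℂ) * A ^ k := rfl
  have hc : |afbmCoeff α k| ≤ afbmCoeff α k ^ 2 + 1 := by
    rw [← sq_abs]
    nlinarith [sq_nonneg (|afbmCoeff α k| - 1), abs_nonneg (afbmCoeff α k)]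
  rw [hz', norm_mul, norm_mul, norm_pow, Complex.norm_real, Real.norm_eq_abs]
  calc |afbmCoeff α k| * ‖a ^ ((2 * α - 2 : ℝ) : ℂ)‖ * ‖A‖ ^ k
      = ‖a ^ ((2 * α - 2 : ℝ) : ℂ)‖ * (|afbmCoeff α k| * ‖A‖ ^ k) := by ring
    _ ≤ ‖a ^ ((2 * α - 2 : ℝ) : ℂ)‖ * ((afbmCoeff α k ^ 2 + 1) * ‖A‖ ^ k) := by gcongr
    _ = _ := by ring

/-- Interpolation between the trivial bound and the Lipschitz bound for `x ^ (2 α - 2)`. -/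
lemma rpow_neg_sub_le {α : ℝ} (hα : 0 < α) (hα' : α < 1 / 2) {ρ : ℝ} (hρ : 0 < ρ) (hρ' : ρ < 1)
    {a b : ℝ} (ha : 0 < a) (hab : a ≤ b) :
    a ^ (2 * α - 2) - b ^ (2 * α - 2) ≤ 2 * (b - a) ^ ρ * a ^ (2 * α - 2 - ρ) := by
  obtain ⟨t, ht, rfl⟩ : ∃ t, 0 ≤ t ∧ b = a * (1 + t) :=
    ⟨(b - a) / a, div_nonneg (by linarith) ha.le, by field_simp; ring⟩
  have e1 : a * (1 + t) - a = a * t := by ring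
  have hbern : 1 - 2 * t ≤ (1 + t) ^ (2 * α - 2) := by
    calc 1 - 2 * t ≤ ((1 + t) ^ 2)⁻¹ := by
          rw [← one_div, le_div_iff₀ (by positivity)]
          nlinarith [mul_nonneg ht ht, mul_nonneg (mul_nonneg ht ht) ht]
      _ = (1 + t) ^ (-2 : ℝ) := by
          rw [Real.rpow_neg (by linarith)]; norm_cast
      _ ≤ (1 + t) ^ (2 * α - 2) :=
          Real.rpow_le_rpow_of_exponent_le (by linarith) (by linarith)
  have hkey : 1 - (1 + t) ^ (2 * α - 2) ≤ 2 * t ^ ρ := by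
    rcases le_total t 1 with h | h
    · have : t ≤ t ^ ρ := by
        simpa using Real.rpow_le_rpow_of_exponent_ge' ht h hρ.le hρ'.le
      linarith
    · have h1 : 1 ≤ t ^ ρ := Real.one_le_rpow h hρ.le
      have h2 : 0 ≤ (1 + t) ^ (2 * α - 2) := by positivity
      linarith
  have e2 : a ^ (2 * α - 2 - ρ) * a ^ ρ = a ^ (2 * α - 2) := by
    rw [← Real.rpow_add ha]; congr 1; ring
  rw [e1, Real.mul_rpow ha.le ht, Real.mul_rpow ha.le (by linarith)]
  calc a ^ (2 * α - 2) - a ^ (2 * α - 2) * (1 + t) ^ (2 * α - 2)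
      = a ^ (2 * α - 2) * (1 - (1 + t) ^ (2 * α - 2)) := by ring
    _ ≤ a ^ (2 * α - 2) * (2 * t ^ ρ) := by gcongr
    _ = _ := by rw [← e2]; ring

include hα hα' in
lemma tsum_norm_sq_afbmBasis_le {z : ℂ} {y a : ℝ} (hy : 0 < y) (hz : y ≤ z.im) (ha : 0 ≤ a) :
    ∑' k, ‖afbmBasis α k (z + a * Complex.I)‖ ^ 2 ≤ afbmConst α * y ^ (2 * α - 2) := by
  have him : (z + a * Complex.I).im = z.im + a := by simp
  rw [(hasSum_norm_sq_afbmBasis hα hα' (by rw [him]; linarith)).tsum_eq, him]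
  have := afbmConst_pos hα hα'
  exact mul_le_mul_of_nonneg_left
    (Real.rpow_le_rpow_of_nonpos hy (by linarith) (by linarith)) this.le

include hα hα' in
/-- Increments of `Γ'` in the vertical direction: `ρ` orders of `|a - b|` are bought at the price
of `ρ` orders of the distance to the real line. -/
lemma tsum_norm_sq_afbmBasis_sub_le {ρ : ℝ} (hρ : 0 < ρ) (hρ' : ρ < 1) {z : ℂ} {y a b : ℝ}
    (hy : 0 < y) (hz : y ≤ z.im) (ha : 0 ≤ a) (hb : 0 ≤ b) :
    ∑' k, ‖afbmBasis α k (z + a * Complex.I) - afbmBasis α k (z + b * Complex.I)‖ ^ 2 ≤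
      afbmConst α * (2 * |a - b| ^ ρ * y ^ (2 * α - 2 - ρ)) := by
  wlog hab : a ≤ b generalizing a b
  · rw [abs_sub_comm]
    refine le_trans (le_of_eq ?_) (this hb ha (le_of_not_ge hab))
    simp_rw [norm_sub_rev]
  have hc := (afbmConst_pos hα hα').le
  rw [(hasSum_norm_sq_afbmBasis_sub hα hα' (by linarith) (by linarith)).tsum_eq]
  refine mul_le_mul_of_nonneg_left ?_ hc
  have h1 : (z.im + b) ^ (2 * α - 2) ≤ (z.im + (a + b) / 2) ^ (2 * α - 2) :=
    Real.rpow_le_rpow_of_nonpos (by linarith) (by linarith) (by linarith)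
  have h2 := rpow_neg_sub_le hα hα' hρ hρ' (a := z.im + a) (b := z.im + b) (by linarith)
    (by linarith)
  have h3 : (z.im + a) ^ (2 * α - 2 - ρ) ≤ y ^ (2 * α - 2 - ρ) :=
    Real.rpow_le_rpow_of_nonpos hy (by linarith) (by linarith)
  have h4 : |a - b| = z.im + b - (z.im + a) := by
    rw [abs_sub_comm, abs_of_nonneg (by linarith)]; ring
  have h5 : 0 ≤ (z.im + b - (z.im + a)) ^ ρ := Real.rpow_nonneg (by linarith) _
  rw [h4]
  have h6 := mul_le_mul_of_nonneg_left h3 (mul_nonneg zero_le_two h5)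
  linarith

end Kernel

/-! ### Complex Gaussian series -/

section GaussianSeries

variable {𝒰 : Type*} [MeasurableSpace 𝒰] {P : Measure 𝒰}

lemma lintegral_exp_sum_gaussian {ι : Type*} {ξ : ι → 𝒰 → ℝ} (hm : ∀ j, Measurable (ξ j))
    (hg : ∀ j, P.map (ξ j) = gaussianReal 0 1) (hi : iIndepFun ξ P) (s : Finset ι) (a : ι → ℝ) :
    ∫⁻ ω, ENNReal.ofReal (Real.exp (∑ j ∈ s, a j * ξ j ω)) ∂P =
      ENNReal.ofReal (Real.exp (∑ j ∈ s, a j ^ 2 / 2)) := by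
  have hi' : iIndepFun (fun j => (fun x => a j * x) ∘ ξ j) P :=
    hi.comp (fun j x => a j * x) fun j => measurable_const_mul (a j)
  have h1 := hi'.mgf_sum (t := 1) (fun j => (measurable_const_mul (a j)).comp (hm j)) s
  have h2 : ∀ j, mgf ((fun x => a j * x) ∘ ξ j) P 1 = Real.exp (a j ^ 2 / 2) := fun j => by
    have := mgf_gaussianReal (hg j) (a j)
    simpa [mgf] using this
  simp only [h2, ← Real.exp_sum] at h1
  have h3 : ∫ ω, Real.exp (∑ j ∈ s, a j * ξ j ω) ∂P = Real.exp (∑ j ∈ s, a j ^ 2 / 2) := by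
    simpa [mgf] using h1
  rw [← h3, ofReal_integral_eq_lintegral_ofReal]
  · refine Integrable.of_integral_ne_zero ?_
    rw [h3]
    exact (Real.exp_pos _).ne'
  · exact ae_of_all _ fun _ => (Real.exp_pos _).le

variable {ξ : ℕ × Fin 2 → 𝒰 → ℝ} (hm : ∀ j, Measurable (ξ j))
  (hg : ∀ j, P.map (ξ j) = gaussianReal 0 1) (hi : iIndepFun ξ P)

/-- The complex Gaussian variable `ξ_k = (ξ¹_k + i ξ²_k) / √2`. -/
noncomputable def complexGaussian (ξ : ℕ × Fin 2 → 𝒰 → ℝ) (k : ℕ) (ω : 𝒰) : ℂ :=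
  ((ξ (k, 0) ω : ℂ) + (ξ (k, 1) ω : ℂ) * Complex.I) / ((√2 : ℝ) : ℂ)

include hm in
lemma measurable_complexGaussian (k : ℕ) : Measurable (complexGaussian ξ k) := by
  have h0 := hm (k, 0)
  have h1 := hm (k, 1)
  unfold complexGaussian
  fun_prop

include hm hg hi in
lemma lintegral_exp_re_sum_complexGaussian (c : ℕ → ℂ) (N : ℕ) :
    ∫⁻ ω, ENNReal.ofReal
      (Real.exp (∑ k ∈ Finset.range N, c k * complexGaussian ξ k ω).re) ∂P =
      ENNReal.ofReal (Real.exp (∑ k ∈ Finset.range N, ‖c k‖ ^ 2 / 4)) := by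
  have h2 : (√2 : ℝ) ^ 2 = 2 := Real.sq_sqrt zero_le_two
  have := lintegral_exp_sum_gaussian hm hg hi (Finset.range N ×ˢ Finset.univ)
    (fun j => if j.2 = 0 then (c j.1).re / √2 else -(c j.1).im / √2)
  simp only [Finset.sum_product, Fin.sum_univ_two] at this
  have e1 : ∀ ω, (∑ k ∈ Finset.range N, c k * complexGaussian ξ k ω).re =
      ∑ k ∈ Finset.range N, ((c k).re / √2 * ξ (k, 0) ω + -(c k).im / √2 * ξ (k, 1) ω) := by
    intro ω
    rw [Complex.re_sum]
    refine Finset.sum_congr rfl fun k _ => ?_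
    simp [complexGaussian, Complex.div_ofReal_re, Complex.div_ofReal_im]
    ring
  have e2 : ∀ k, ‖c k‖ ^ 2 / 4 = ((c k).re / √2) ^ 2 / 2 + (-(c k).im / √2) ^ 2 / 2 := by
    intro k
    rw [← Complex.normSq_eq_norm_sq, Complex.normSq_apply]
    simp only [div_pow, h2]
    ring
  simpa [e1, e2] using this

/-- Reduction of the modulus to real parts: one of `±z`, `±iz` has real part at least `|z| / 2`. -/
lemma exp_mul_norm_le {l : ℝ} (hl : 0 ≤ l) (z : ℂ) :
    Real.exp (l * ‖z‖) ≤
      ∑ u ∈ ({1, -1, Complex.I, -Complex.I} : Finset ℂ), Real.exp (((2 * l : ℝ) : ℂ) * u * z).re := by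
  have hmem : ∃ u ∈ ({1, -1, Complex.I, -Complex.I} : Finset ℂ),
      l * ‖z‖ ≤ (((2 * l : ℝ) : ℂ) * u * z).re := by
    have h := Complex.norm_le_abs_re_add_abs_im z
    rcases le_total |z.im| |z.re| with h1 | h1
    · rcases abs_cases z.re with h2 | h2
      · refine ⟨1, by simp, ?_⟩
        simp; nlinarith
      · refine ⟨-1, by simp, ?_⟩
        simp; nlinarith
    · rcases abs_cases z.im with h2 | h2
      · refine ⟨-Complex.I, by simp, ?_⟩
        simp; nlinarith
      · refine ⟨Complex.I, by simp, ?_⟩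
        simp; nlinarith
  obtain ⟨u, hu, h⟩ := hmem
  exact (Real.exp_le_exp.2 h).trans
    (Finset.single_le_sum (f := fun u => Real.exp (((2 * l : ℝ) : ℂ) * u * z).re)
      (fun _ _ => (Real.exp_pos _).le) hu)

include hm hg hi in
lemma lintegral_exp_norm_sum_complexGaussian_le {l : ℝ} (hl : 0 ≤ l) (c : ℕ → ℂ) (N : ℕ) :
    ∫⁻ ω, ENNReal.ofReal
      (Real.exp (l * ‖∑ k ∈ Finset.range N, c k * complexGaussian ξ k ω‖)) ∂P ≤
      4 * ENNReal.ofReal (Real.exp (l ^ 2 * ∑ k ∈ Finset.range N, ‖c k‖ ^ 2)) := by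
  have hmeas := measurable_complexGaussian hm
  set T : Finset ℂ := {1, -1, Complex.I, -Complex.I} with hT
  have hcard : T.card ≤ 4 := Finset.card_le_four
  have hnorm : ∀ u ∈ T, ‖u‖ = 1 := by simp [hT]
  calc _ ≤ ∫⁻ ω, ∑ u ∈ T, ENNReal.ofReal (Real.exp
        (∑ k ∈ Finset.range N, (((2 * l : ℝ) : ℂ) * u * c k) * complexGaussian ξ k ω).re) ∂P := by
        refine lintegral_mono fun ω => ?_
        rw [← ENNReal.ofReal_sum_of_nonneg fun _ _ => (Real.exp_pos _).le]
        refine ENNReal.ofReal_le_ofReal ((exp_mul_norm_le hl _).trans (le_of_eq ?_))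
        refine Finset.sum_congr rfl fun u _ => ?_
        rw [Finset.mul_sum]
        simp only [mul_assoc]
    _ = ∑ u ∈ T, ENNReal.ofReal (Real.exp (l ^ 2 * ∑ k ∈ Finset.range N, ‖c k‖ ^ 2)) := by
        rw [lintegral_finsetSum _ fun u _ => by fun_prop]
        refine Finset.sum_congr rfl fun u hu => ?_
        rw [lintegral_exp_re_sum_complexGaussian hm hg hi, Finset.mul_sum]
        congr 2
        refine Finset.sum_congr rfl fun k _ => ?_
        rw [norm_mul, norm_mul, hnorm u hu, Complex.norm_real, Real.norm_eq_abs, mul_pow, mul_pow,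
          sq_abs]
        ring
    _ ≤ _ := by
        rw [Finset.sum_const, nsmul_eq_mul]
        gcongr
        exact_mod_cast hcard

include hm hg hi in
/-- Sub-Gaussian bound for a complex Gaussian series. By Fatou's lemma no convergence of the
series has to be known: where it diverges its value is `0`. -/
lemma lintegral_exp_norm_tsum_complexGaussian_le {l : ℝ} (hl : 0 ≤ l) {c : ℕ → ℂ}
    (hc : Summable fun k => ‖c k‖ ^ 2) :
    ∫⁻ ω, ENNReal.ofReal (Real.exp (l * ‖∑' k, c k * complexGaussian ξ k ω‖)) ∂P ≤
      4 * ENNReal.ofReal (Real.exp (l ^ 2 * ∑' k, ‖c k‖ ^ 2)) := by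
  have hmeas := measurable_complexGaussian hm
  set F : ℕ → 𝒰 → ENNReal := fun N ω => ENNReal.ofReal
    (Real.exp (l * ‖∑ k ∈ Finset.range N, c k * complexGaussian ξ k ω‖)) with hF
  calc _ ≤ ∫⁻ ω, liminf (fun N => F N ω) atTop ∂P := by
        refine lintegral_mono fun ω => ?_
        by_cases hs : Summable fun k => c k * complexGaussian ξ k ω
        · have ht : Tendsto (fun N => F N ω) atTop (𝓝 (ENNReal.ofReal
              (Real.exp (l * ‖∑' k, c k * complexGaussian ξ k ω‖)))) := by
            refine (ENNReal.continuous_ofReal.tendsto _).comp ?_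
            refine (Real.continuous_exp.tendsto _).comp ?_
            exact (hs.hasSum.tendsto_sum_nat.norm).const_mul l
          exact ht.liminf_eq.ge
        · rw [tsum_eq_zero_of_not_summable hs]
          refine le_liminf_of_le (by isBoundedDefault) (Eventually.of_forall fun N => ?_)
          refine ENNReal.ofReal_le_ofReal (Real.exp_le_exp.2 ?_)
          simp only [norm_zero, mul_zero]
          positivity
    _ ≤ liminf (fun N => ∫⁻ ω, F N ω ∂P) atTop :=
        lintegral_liminf_le fun N => by simp only [hF]; fun_prop
    _ ≤ _ := by
        refine liminf_le_of_le (by isBoundedDefault) fun b hb => ?_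
        obtain ⟨N, hN⟩ := hb.exists
        refine hN.trans ((lintegral_exp_norm_sum_complexGaussian_le hm hg hi hl c N).trans ?_)
        gcongr
        exact hc.sum_le_tsum _ fun _ _ => by positivity

include hm hg in
/-- Almost sure summability, needed to subtract two series without meeting the junk value of a
divergent one. -/
lemma ae_summable_mul_complexGaussian {c : ℕ → ℂ} (hc : Summable fun k => ‖c k‖) :
    ∀ᵐ ω ∂P, Summable fun k => c k * complexGaussian ξ k ω := by
  have hmeas := measurable_complexGaussian hm
  set M : ENNReal := ∫⁻ x, ‖x‖ₑ ∂(gaussianReal 0 1) with hM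
  have hMtop : M ≠ ⊤ := by
    have := (memLp_id_gaussianReal (μ := 0) (v := 1) 1).integrable (by simp)
    exact this.2.ne
  have hj : ∀ j, ∫⁻ ω, ‖ξ j ω‖ₑ ∂P = M := fun j => by
    rw [hM, ← hg j, lintegral_map measurable_enorm (hm j)]
  have h2 : ∀ k ω, ‖complexGaussian ξ k ω‖ₑ ≤ ‖ξ (k, 0) ω‖ₑ + ‖ξ (k, 1) ω‖ₑ := by
    intro k ω
    rw [← ofReal_norm, ← ofReal_norm, ← ofReal_norm,
      ← ENNReal.ofReal_add (norm_nonneg _) (norm_nonneg _)]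
    refine ENNReal.ofReal_le_ofReal ?_
    rw [complexGaussian, norm_div]
    refine (div_le_self (norm_nonneg _) ?_).trans ((norm_add_le _ _).trans ?_)
    · rw [Complex.norm_real, Real.norm_eq_abs]
      exact le_abs.2 (Or.inl (Real.one_le_sqrt.2 one_le_two))
    · simp
  have hfin : ∫⁻ ω, ∑' k, ‖c k * complexGaussian ξ k ω‖ₑ ∂P ≠ ⊤ := by
    rw [lintegral_tsum fun k => by fun_prop]
    have hb : ∀ k, ∫⁻ ω, ‖c k * complexGaussian ξ k ω‖ₑ ∂P ≤ ‖c k‖ₑ * (M + M) := by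
      intro k
      calc _ ≤ ∫⁻ ω, ‖c k‖ₑ * (‖ξ (k, 0) ω‖ₑ + ‖ξ (k, 1) ω‖ₑ) ∂P := by
            refine lintegral_mono fun ω => ?_
            rw [enorm_mul]
            gcongr
            exact h2 k ω
        _ = _ := by
            rw [lintegral_const_mul' _ _ enorm_ne_top, lintegral_add_left (hm _).enorm, hj, hj]
    refine ne_top_of_le_ne_top ?_ (ENNReal.tsum_le_tsum hb)
    rw [ENNReal.tsum_mul_right]
    refine ENNReal.mul_ne_top ?_ (ENNReal.add_ne_top.2 ⟨hMtop, hMtop⟩)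
    have : ∀ k, ‖c k‖ₑ = ((‖c k‖₊ : NNReal) : ENNReal) := fun k => rfl
    simp only [this]
    rw [ENNReal.tsum_coe_ne_top_iff_summable, ← NNReal.summable_coe]
    exact hc
  filter_upwards [ae_lt_top' (Measurable.tsum fun k => by fun_prop).aemeasurable hfin]
    with ω hω
  rw [← summable_norm_iff]
  have : ∀ k, ‖c k * complexGaussian ξ k ω‖ₑ =
    ((‖c k * complexGaussian ξ k ω‖₊ : NNReal) : ENNReal) := fun k => rfl
  simp only [this] at hω
  have := ENNReal.tsum_coe_ne_top_iff_summable.1 hω.ne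
  rw [← NNReal.summable_coe] at this
  exact this

/-! ### The derivative of the analytic fractional Brownian motion -/

/-- `Γ'_z` for one component, as a function of the sample and of the point. -/
noncomputable def afbmField (α : ℝ) (ξ : ℕ × Fin 2 → 𝒰 → ℝ) (ω : 𝒰) (z : ℂ) : ℂ :=
  afbmDeriv α (fun k => ξ (k, 0) ω) (fun k => ξ (k, 1) ω) z

omit [MeasurableSpace 𝒰] in
lemma afbmField_eq (α : ℝ) (ω : 𝒰) (z : ℂ) :
    afbmField α ξ ω z = ∑' k, afbmBasis α k z * complexGaussian ξ k ω := rfl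

include hm in
lemma measurable_afbmField (α : ℝ) {X : Type*} [MeasurableSpace X] {f : X → 𝒰} {g : X → ℂ}
    (hf : Measurable f) (hg : Measurable g) :
    Measurable (fun x => afbmField α ξ (f x) (g x)) := by
  have hmeas := fun k => (measurable_complexGaussian hm k).comp hf
  simp only [Function.comp_def] at hmeas
  simp only [afbmField_eq]
  refine Measurable.tsum fun k => ?_
  unfold afbmBasis
  fun_prop

variable {α : ℝ} (hα : 0 < α) (hα' : α < 1 / 2)

include hm hg hi hα hα' in
lemma lintegral_exp_afbmField_le {l : ℝ} (hl : 0 ≤ l) {z : ℂ} {y a : ℝ} (hy : 0 < y)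
    (hz : y ≤ z.im) (ha : 0 ≤ a) :
    ∫⁻ ω, ENNReal.ofReal (Real.exp (l * ‖afbmField α ξ ω (z + a * Complex.I)‖)) ∂P ≤
      4 * ENNReal.ofReal (Real.exp (l ^ 2 * (afbmConst α * y ^ (2 * α - 2)))) := by
  have him : (z + a * Complex.I).im = z.im + a := by simp
  refine (lintegral_exp_norm_tsum_complexGaussian_le hm hg hi hl
    (hasSum_norm_sq_afbmBasis hα hα' (by rw [him]; linarith)).summable).trans ?_
  gcongr
  exact tsum_norm_sq_afbmBasis_le hα hα' hy hz ha

include hm hg hi hα hα' in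
lemma lintegral_exp_afbmField_sub_le {l : ℝ} (hl : 0 ≤ l) {ρ : ℝ} (hρ : 0 < ρ) (hρ' : ρ < 1)
    {z : ℂ} {y a b : ℝ} (hy : 0 < y) (hz : y ≤ z.im) (ha : 0 ≤ a) (hb : 0 ≤ b) :
    ∫⁻ ω, ENNReal.ofReal (Real.exp (l * ‖afbmField α ξ ω (z + a * Complex.I) -
        afbmField α ξ ω (z + b * Complex.I)‖)) ∂P ≤
      4 * ENNReal.ofReal (Real.exp (l ^ 2 *
        (afbmConst α * (2 * |a - b| ^ ρ * y ^ (2 * α - 2 - ρ))))) := by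
  have ha' : 0 < (z + a * Complex.I).im := by simp; linarith
  have hb' : 0 < (z + b * Complex.I).im := by simp; linarith
  have hae : ∀ᵐ ω ∂P, afbmField α ξ ω (z + a * Complex.I) - afbmField α ξ ω (z + b * Complex.I) =
      ∑' k, (afbmBasis α k (z + a * Complex.I) - afbmBasis α k (z + b * Complex.I)) *
        complexGaussian ξ k ω := by
    filter_upwards [ae_summable_mul_complexGaussian hm hg (summable_norm_afbmBasis hα hα' ha'),
      ae_summable_mul_complexGaussian hm hg (summable_norm_afbmBasis hα hα' hb')] with ω h1 h2
    rw [afbmField_eq, afbmField_eq, ← h1.tsum_sub h2]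
    simp only [sub_mul]
  rw [lintegral_congr_ae (g := fun ω => ENNReal.ofReal (Real.exp (l * ‖∑' k,
    (afbmBasis α k (z + a * Complex.I) - afbmBasis α k (z + b * Complex.I)) *
        complexGaussian ξ k ω‖))) (hae.mono fun ω h => by simp only [h])]
  refine (lintegral_exp_norm_tsum_complexGaussian_le hm hg hi hl
    (hasSum_norm_sq_afbmBasis_sub hα hα' (by linarith) (by linarith)).summable).trans ?_
  gcongr
  exact tsum_norm_sq_afbmBasis_sub_le hα hα' hρ hρ' hy hz ha hb

end GaussianSeries

/-! ### The arch over a segment -/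

lemma convex_upper (c : ℝ) : Convex ℝ {z : ℂ | c < z.im} :=
  convex_halfSpace_im_gt c

lemma isOpen_upper (c : ℝ) : IsOpen {z : ℂ | c < z.im} :=
  isOpen_lt continuous_const Complex.continuous_im

/-- The arch `r ↦ s + r (t - s) + i |t - s| r (1 - r)` from `s` to `t`. -/
noncomputable def arch (s t : ℂ) (r : ℝ) : ℂ :=
  s + (r : ℂ) * (t - s) + ((‖t - s‖ * (r * (1 - r)) : ℝ) : ℂ) * Complex.I

/-- The velocity of `arch`. -/
noncomputable def archDeriv (s t : ℂ) (r : ℝ) : ℂ :=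
  (t - s) + ((‖t - s‖ * (1 - 2 * r) : ℝ) : ℂ) * Complex.I

lemma hasDerivAt_arch (s t : ℂ) (r : ℝ) : HasDerivAt (arch s t) (archDeriv s t r) r := by
  have h1 : HasDerivAt (fun r : ℝ => s + (r : ℂ) * (t - s)) (t - s) r := by
    simpa using ((Complex.ofRealCLM.hasDerivAt (x := r)).mul_const (t - s)).const_add s
  have h2 : HasDerivAt (fun r : ℝ => ‖t - s‖ * (r * (1 - r))) (‖t - s‖ * (1 - 2 * r)) r := by
    have := ((hasDerivAt_id r).mul ((hasDerivAt_id r).const_sub 1)).const_mul ‖t - s‖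
    refine this.congr_deriv ?_
    simp only [id]
    ring
  exact h1.add (h2.ofReal_comp.mul_const Complex.I)

lemma continuous_arch (s t : ℂ) : Continuous (arch s t) :=
  continuous_iff_continuousAt.2 fun r => (hasDerivAt_arch s t r).continuousAt

lemma norm_archDeriv_le (s t : ℂ) {r : ℝ} (hr : r ∈ Set.Icc (0 : ℝ) 1) :
    ‖archDeriv s t r‖ ≤ 2 * ‖t - s‖ := by
  refine (norm_add_le _ _).trans ?_
  rw [norm_mul, Complex.norm_I, mul_one, Complex.norm_real, norm_mul, norm_norm, Real.norm_eq_abs]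
  have : |1 - 2 * r| ≤ 1 := abs_le.2 ⟨by linarith [hr.2], by linarith [hr.1]⟩
  nlinarith [norm_nonneg (t - s)]

lemma le_im_arch {s t : ℂ} (hs : 0 ≤ s.im) (ht : 0 ≤ t.im) {r : ℝ} (hr : r ∈ Set.Icc (0 : ℝ) 1) :
    ‖t - s‖ * (r * (1 - r)) ≤ (arch s t r).im := by
  have : (arch s t r).im = (1 - r) * s.im + r * t.im + ‖t - s‖ * (r * (1 - r)) := by
    simp [arch]
    ring
  rw [this]
  have := mul_nonneg (sub_nonneg.2 hr.2) hs
  have := mul_nonneg hr.1 ht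
  linarith

/-- The density along the arch that controls both the iterated integrals of `D(· + iε)` and
`D(· + iη)`, in units of `q`, and their difference, in units of `q'`. -/
noncomputable def archDensity {d : ℕ} (D : Fin d → ℂ → ℂ) (s t : ℂ) (ε η q q' : ℝ) (r : ℝ) : ℝ :=
  ∑ i, (2 * ‖t - s‖ / q * ‖D i (arch s t r + ε * Complex.I)‖ +
    2 * ‖t - s‖ / q * ‖D i (arch s t r + η * Complex.I)‖ +
    2 * ‖t - s‖ / q' * ‖D i (arch s t r + ε * Complex.I) - D i (arch s t r + η * Complex.I)‖)

section Deterministic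

variable {d : ℕ} {D : Fin d → ℂ → ℂ} (hD : ∀ i, DifferentiableOn ℂ (D i) upperHalf)
  {s t : ℂ} (hs : 0 ≤ s.im) (ht : 0 ≤ t.im) {ε η : ℝ} (hε : 0 < ε) (hη : 0 < η)

include hD hs ht in
lemma continuousOn_comp_arch {a : ℝ} (ha : 0 < a) (i : Fin d) :
    ContinuousOn (fun r => D i (arch s t r + a * Complex.I)) (Set.Icc 0 1) := by
  refine (hD i).continuousOn.comp ((continuous_arch s t).add continuous_const).continuousOn ?_
  intro r hr
  have h1 := le_im_arch hs ht hr
  have h2 : 0 ≤ ‖t - s‖ * (r * (1 - r)) :=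
    mul_nonneg (norm_nonneg _) (mul_nonneg hr.1 (sub_nonneg.2 hr.2))
  simp only [upperHalf, Set.mem_ofPred_eq, Complex.add_im, Complex.mul_im, Complex.ofReal_re,
    Complex.I_im, mul_one, Complex.ofReal_im, Complex.I_re, mul_zero, add_zero]
  linarith

include hD hs ht hε hη in
lemma continuousOn_archDensity (q q' : ℝ) :
    ContinuousOn (archDensity D s t ε η q q') (Set.Icc 0 1) := by
  refine continuousOn_finsetSum _ fun i _ => ?_
  have h1 := continuousOn_comp_arch hD hs ht hε i
  have h2 := continuousOn_comp_arch hD hs ht hη i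
  exact ((continuousOn_const.mul h1.norm).add (continuousOn_const.mul h2.norm)).add
    (continuousOn_const.mul (h1.sub h2).norm)

lemma differentiableOn_shift (hD : ∀ i, DifferentiableOn ℂ (D i) upperHalf) {a c : ℝ}
    (hc : c ≤ a) (i : Fin d) :
    DifferentiableOn ℂ (fun z => D i (z + a * Complex.I)) {z | -c < z.im} := by
  refine (hD i).comp (by fun_prop) ?_
  intro z hz
  have : -c < z.im := hz
  simp only [upperHalf, Set.mem_ofPred_eq, Complex.add_im, Complex.mul_im, Complex.ofReal_re,
    Complex.I_im, mul_one, Complex.ofReal_im, Complex.I_re, mul_zero, add_zero]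
  linarith

include hD hs ht hε hη in
/-- Pathwise comparison of the two regularizations. The bound `b aⁿ / n!` coming from the simplex
is replaced by `exp (a + b)`, which no longer depends on the order of the iterated integral. -/
lemma norm_iteratedFormIntegral_shift_sub_le {q q' : ℝ} (hq : 0 < q) (hq' : 0 < q') (n : ℕ)
    (i : Fin (n + 1) → Fin d) :
    ‖iteratedFormIntegral (n + 1) (fun j z => D (i j) (z + ε * Complex.I)) s t -
      iteratedFormIntegral (n + 1) (fun j z => D (i j) (z + η * Complex.I)) s t‖ ≤
      q' * q ^ n * Real.exp (∫ r in (0 : ℝ)..1, archDensity D s t ε η q q' r) := by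
  set τ := ‖t - s‖ with hτ
  have hτ0 : 0 ≤ τ := norm_nonneg _
  set φ₀ : ℝ → ℝ := fun r => ∑ i, (2 * τ / q * ‖D i (arch s t r + ε * Complex.I)‖ +
    2 * τ / q * ‖D i (arch s t r + η * Complex.I)‖) with hφ₀
  set ψ₀ : ℝ → ℝ := fun r => ∑ i, 2 * τ / q' *
    ‖D i (arch s t r + ε * Complex.I) - D i (arch s t r + η * Complex.I)‖ with hψ₀
  have hadd : archDensity D s t ε η q q' = fun r => φ₀ r + ψ₀ r := by
    funext r
    simp only [archDensity, hφ₀, hψ₀, ← hτ, Finset.sum_add_distrib]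
  have hφc : ContinuousOn φ₀ (Set.Icc 0 1) := continuousOn_finsetSum _ fun i _ =>
    (continuousOn_const.mul (continuousOn_comp_arch hD hs ht hε i).norm).add
      (continuousOn_const.mul (continuousOn_comp_arch hD hs ht hη i).norm)
  have hψc : ContinuousOn ψ₀ (Set.Icc 0 1) := continuousOn_finsetSum _ fun i _ =>
    continuousOn_const.mul ((continuousOn_comp_arch hD hs ht hε i).sub
      (continuousOn_comp_arch hD hs ht hη i)).norm
  have hφ₀0 : ∀ r, 0 ≤ φ₀ r := fun r => Finset.sum_nonneg fun i _ => by positivity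
  have hψ₀0 : ∀ r, 0 ≤ ψ₀ r := fun r => Finset.sum_nonneg fun i _ => by positivity
  have h01 : (0 : ℝ) ≤ 1 := zero_le_one
  -- The densities are continuous on `[0, 1]` only; they are extended constantly outside.
  set π : ℝ → ℝ := fun r => (Set.projIcc 0 1 h01 r : ℝ) with hπ
  have hπc : Continuous π := continuous_subtype_val.comp continuous_projIcc
  have hπI : ∀ r ∈ Set.Icc (0 : ℝ) 1, π r = r := fun r hr => by
    simp [hπ, Set.projIcc_of_mem h01 hr]
  have hπm : ∀ r, π r ∈ Set.Icc (0 : ℝ) 1 := fun r => (Set.projIcc 0 1 h01 r).2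
  have hφ' : Continuous (fun r => q * φ₀ (π r)) :=
    continuous_const.mul (hφc.comp_continuous hπc hπm)
  have hψ' : Continuous (fun r => q' * ψ₀ (π r)) :=
    continuous_const.mul (hψc.comp_continuous hπc hπm)
  set U : Set ℂ := {z | -(min ε η) < z.im}
  have hU : ∀ r ∈ Set.Icc (0 : ℝ) 1, arch s t r ∈ U := by
    intro r hr
    have h1 := le_im_arch hs ht hr
    have h2 : 0 ≤ τ * (r * (1 - r)) :=
      mul_nonneg hτ0 (mul_nonneg hr.1 (sub_nonneg.2 hr.2))
    have h3 : 0 < min ε η := lt_min hε hη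
    change -(min ε η) < (arch s t r).im
    linarith
  have hφb : ∀ a : ℝ, (a = ε ∨ a = η) → ∀ j, ∀ r ∈ Set.Icc (0 : ℝ) 1,
      ‖archDeriv s t r‖ * ‖D (i j) (arch s t r + a * Complex.I)‖ ≤ q * φ₀ (π r) := by
    intro a ha j r hr
    rw [hπI r hr]
    have h1 : 2 * τ / q * ‖D (i j) (arch s t r + a * Complex.I)‖ ≤ φ₀ r := by
      refine le_trans ?_ (Finset.single_le_sum (f := fun i =>
        2 * τ / q * ‖D i (arch s t r + ε * Complex.I)‖ +
          2 * τ / q * ‖D i (arch s t r + η * Complex.I)‖)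
        (fun i _ => by positivity) (Finset.mem_univ (i j)))
      rcases ha with rfl | rfl
      · exact le_add_of_nonneg_right (by positivity)
      · exact le_add_of_nonneg_left (by positivity)
    calc _ ≤ 2 * τ * ‖D (i j) (arch s t r + a * Complex.I)‖ := by
          gcongr; exact norm_archDeriv_le s t hr
      _ = q * (2 * τ / q * ‖D (i j) (arch s t r + a * Complex.I)‖) := by field_simp
      _ ≤ _ := by gcongr
  have hψb : ∀ j, ∀ r ∈ Set.Icc (0 : ℝ) 1, ‖archDeriv s t r‖ *
      ‖D (i j) (arch s t r + ε * Complex.I) - D (i j) (arch s t r + η * Complex.I)‖ ≤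
        q' * ψ₀ (π r) := by
    intro j r hr
    rw [hπI r hr]
    have h1 := Finset.single_le_sum (f := fun i =>
        2 * τ / q' * ‖D i (arch s t r + ε * Complex.I) - D i (arch s t r + η * Complex.I)‖)
        (fun i _ => by positivity) (Finset.mem_univ (i j))
    calc _ ≤ 2 * τ * ‖D (i j) (arch s t r + ε * Complex.I) -
            D (i j) (arch s t r + η * Complex.I)‖ := by
          gcongr; exact norm_archDeriv_le s t hr
      _ = q' * (2 * τ / q' * ‖D (i j) (arch s t r + ε * Complex.I) -
            D (i j) (arch s t r + η * Complex.I)‖) := by field_simp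
      _ ≤ _ := mul_le_mul_of_nonneg_left h1 hq'.le
  have key := norm_iteratedFormIntegral_sub_le (convex_upper _) (isOpen_upper _) hU
    (hasDerivAt_arch s t) hφ' (fun r => mul_nonneg hq.le (hφ₀0 _)) hψ' n
    (fun j z => D (i j) (z + ε * Complex.I)) (fun j z => D (i j) (z + η * Complex.I))
    (fun j => differentiableOn_shift hD (min_le_left _ _) (i j))
    (fun j => differentiableOn_shift hD (min_le_right _ _) (i j))
    (hφb ε (Or.inl rfl)) (hφb η (Or.inr rfl)) hψb 1 (by simp)
  have e0 : arch s t 0 = s := by simp [arch]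
  have e1 : arch s t 1 = t := by simp [arch]
  rw [e0, e1] at key
  refine key.trans ?_
  have hIφ : ∫ r in (0 : ℝ)..1, q * φ₀ (π r) = q * ∫ r in (0 : ℝ)..1, φ₀ r := by
    rw [intervalIntegral.integral_const_mul]
    congr 1
    refine intervalIntegral.integral_congr fun r hr => ?_
    rw [Set.uIcc_of_le h01] at hr
    simp only [hπI r hr]
  have hIψ : ∫ r in (0 : ℝ)..1, q' * ψ₀ (π r) = q' * ∫ r in (0 : ℝ)..1, ψ₀ r := by
    rw [intervalIntegral.integral_const_mul]
    congr 1
    refine intervalIntegral.integral_congr fun r hr => ?_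
    rw [Set.uIcc_of_le h01] at hr
    simp only [hπI r hr]
  rw [hIφ, hIψ, hadd, intervalIntegral.integral_add (hφc.intervalIntegrable_of_Icc h01)
    (hψc.intervalIntegrable_of_Icc h01)]
  set a := ∫ r in (0 : ℝ)..1, φ₀ r
  set b := ∫ r in (0 : ℝ)..1, ψ₀ r
  have ha : 0 ≤ a := intervalIntegral.integral_nonneg h01 fun r _ => hφ₀0 r
  have hb : 0 ≤ b := intervalIntegral.integral_nonneg h01 fun r _ => hψ₀0 r
  calc q' * b * ((q * a) ^ n / n.factorial) = q' * q ^ n * ((a ^ n / n.factorial) * b) := by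
        rw [mul_pow]; ring
    _ ≤ q' * q ^ n * (Real.exp a * Real.exp b) := by
        gcongr
        · exact Real.pow_div_factorial_le_exp _ ha n
        · linarith [Real.add_one_le_exp b]
    _ = _ := by rw [Real.exp_add]

end Deterministic

/-! ### Exponential moments -/

lemma ofReal_integral_le_lintegral_ofReal {X : Type*} [MeasurableSpace X] {μ : Measure X}
    {f : X → ℝ} (hf : Integrable f μ) :
    ENNReal.ofReal (∫ x, f x ∂μ) ≤ ∫⁻ x, ENNReal.ofReal (f x) ∂μ := by
  calc ENNReal.ofReal (∫ x, f x ∂μ) ≤ ENNReal.ofReal (∫ x, max (f x) 0 ∂μ) :=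
        ENNReal.ofReal_le_ofReal (integral_mono hf hf.pos_part fun x => le_max_left _ _)
    _ = ∫⁻ x, ENNReal.ofReal (max (f x) 0) ∂μ :=
        ofReal_integral_eq_lintegral_ofReal hf.pos_part (ae_of_all _ fun _ => le_max_right _ _)
    _ = _ := by simp

/-- Jensen's inequality for the exponential, with respect to the probability density `w / ∫ w`. -/
lemma ofReal_exp_integral_le {X : Type*} [MeasurableSpace X] {μ : Measure X} {w f : X → ℝ}
    (hw : Integrable w μ) (hw0 : ∀ᵐ x ∂μ, 0 < w x) (hJ : 0 < ∫ x, w x ∂μ) (hf : Integrable f μ) :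
    ENNReal.ofReal (Real.exp (∫ x, f x ∂μ)) ≤
      ∫⁻ x, ENNReal.ofReal (Real.exp ((∫ x, w x ∂μ) * f x / w x)) *
        ENNReal.ofReal (w x / ∫ x, w x ∂μ) ∂μ := by
  set J := ∫ x, w x ∂μ with hJdef
  set m := ∫ x, f x ∂μ with hm
  have hint : Integrable (fun x => Real.exp m * ((1 - m) / J * w x + f x)) μ :=
    ((hw.const_mul _).add hf).const_mul _
  have hval : ∫ x, Real.exp m * ((1 - m) / J * w x + f x) ∂μ = Real.exp m := by
    rw [integral_const_mul, integral_add (hw.const_mul _) hf, integral_const_mul, ← hJdef, ← hm]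
    field_simp
    ring
  rw [← hval]
  refine (ofReal_integral_le_lintegral_ofReal hint).trans (lintegral_mono_ae ?_)
  filter_upwards [hw0] with x hx
  rw [← ENNReal.ofReal_mul (Real.exp_pos _).le]
  refine ENNReal.ofReal_le_ofReal ?_
  have h1 : Real.exp m * (J * f x / w x - m + 1) ≤ Real.exp (J * f x / w x) := by
    calc _ ≤ Real.exp m * Real.exp (J * f x / w x - m) := by
          gcongr; exact Real.add_one_le_exp _
      _ = _ := by rw [← Real.exp_add]; congr 1; ring
  calc Real.exp m * ((1 - m) / J * w x + f x)
      = Real.exp m * (J * f x / w x - m + 1) * (w x / J) := by field_simp; ring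
    _ ≤ _ := by gcongr

lemma exp_sum_le_sum_exp {ι : Type*} {s : Finset ι} (hs : s.Nonempty) (x : ι → ℝ) :
    Real.exp (∑ i ∈ s, x i) ≤ ∑ i ∈ s, Real.exp (s.card * x i) := by
  obtain ⟨i, hi, him⟩ := s.exists_max_image x hs
  calc Real.exp (∑ i ∈ s, x i) ≤ Real.exp (s.card * x i) := by
        rw [Real.exp_le_exp, ← nsmul_eq_mul]
        exact Finset.sum_le_card_nsmul _ _ _ him
    _ ≤ _ := Finset.single_le_sum (f := fun i => Real.exp (s.card * x i))
        (fun _ _ => (Real.exp_pos _).le) hi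

lemma exp_add_add_le (a b c : ℝ) :
    Real.exp (a + b + c) ≤ Real.exp (3 * a) + Real.exp (3 * b) + Real.exp (3 * c) := by
  have := exp_sum_le_sum_exp (s := (Finset.univ : Finset (Fin 3))) Finset.univ_nonempty ![a, b, c]
  simpa [Fin.sum_univ_three] using this

/-- The weight `(r (1 - r)) ^ (α - 1 - ρ/2)` on `(0, 1)`: the size of the density along the
arch. It is integrable exactly because `ρ < 2 α`. -/
noncomputable def archWeight (α ρ r : ℝ) : ℝ := (r * (1 - r)) ^ (α - 1 - ρ / 2)

lemma integrableOn_archWeight {α ρ : ℝ} (h : ρ < 2 * α) :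
    IntegrableOn (archWeight α ρ) (Set.Ioo 0 1) := by
  have hu : 0 < ((α - ρ / 2 : ℝ) : ℂ).re := by rw [Complex.ofReal_re]; linarith
  have h1 := (Complex.betaIntegral_convergent hu hu).norm
  rw [intervalIntegrable_iff_integrableOn_Ioo_of_le zero_le_one] at h1
  refine h1.congr_fun (fun r hr => ?_) measurableSet_Ioo
  have h2 : 0 < 1 - r := sub_pos.2 hr.2
  have h3 : (1 : ℂ) - r = ((1 - r : ℝ) : ℂ) := by push_cast; rfl
  simp only [norm_mul]
  rw [h3, Complex.norm_cpow_eq_rpow_re_of_pos hr.1, Complex.norm_cpow_eq_rpow_re_of_pos h2,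
    ← Real.mul_rpow hr.1.le h2.le, archWeight]
  congr 1
  simp
  ring

lemma archWeight_pos {α ρ r : ℝ} (hr : r ∈ Set.Ioo (0 : ℝ) 1) : 0 < archWeight α ρ r :=
  Real.rpow_pos_of_pos (mul_pos hr.1 (sub_pos.2 hr.2)) _

lemma measurable_archWeight (α ρ : ℝ) : Measurable (archWeight α ρ) := by
  unfold archWeight
  fun_prop

lemma integral_archWeight_pos {α ρ : ℝ} (h : ρ < 2 * α) :
    0 < ∫ r in Set.Ioo (0 : ℝ) 1, archWeight α ρ r := by
  rw [setIntegral_pos_iff_support_of_nonneg_ae]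
  · have : Set.Ioo (0 : ℝ) 1 ⊆ Function.support (archWeight α ρ) ∩ Set.Ioo 0 1 :=
      fun r hr => ⟨(archWeight_pos hr).ne', hr⟩
    exact lt_of_lt_of_le (by simp) (measure_mono this)
  · filter_upwards [ae_restrict_mem measurableSet_Ioo] with r hr using (archWeight_pos hr).le
  · exact integrableOn_archWeight h

lemma exp_archDensity_le {d : ℕ} (hd : 0 < d) (D : Fin d → ℂ → ℂ) (s t : ℂ) (ε η q q' l w r : ℝ) :
    Real.exp (l * archDensity D s t ε η q q' r / w) ≤
      ∑ i, (Real.exp (3 * (d * l) * (2 * ‖t - s‖ / q) / w *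
          ‖D i (arch s t r + ε * Complex.I)‖) +
        Real.exp (3 * (d * l) * (2 * ‖t - s‖ / q) / w * ‖D i (arch s t r + η * Complex.I)‖) +
        Real.exp (3 * (d * l) * (2 * ‖t - s‖ / q') / w *
          ‖D i (arch s t r + ε * Complex.I) - D i (arch s t r + η * Complex.I)‖)) := by
  have hne : (Finset.univ : Finset (Fin d)).Nonempty := ⟨⟨0, hd⟩, Finset.mem_univ _⟩
  have e1 : l * archDensity D s t ε η q q' r / w =
      ∑ i, (l * (2 * ‖t - s‖ / q) / w * ‖D i (arch s t r + ε * Complex.I)‖ +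
        l * (2 * ‖t - s‖ / q) / w * ‖D i (arch s t r + η * Complex.I)‖ +
        l * (2 * ‖t - s‖ / q') / w *
          ‖D i (arch s t r + ε * Complex.I) - D i (arch s t r + η * Complex.I)‖) := by
    rw [archDensity, Finset.mul_sum, Finset.sum_div]
    refine Finset.sum_congr rfl fun i _ => ?_
    ring
  have e2 : ∀ c N : ℝ, 3 * (d * (l * c / w * N)) = 3 * (d * l) * c / w * N :=
    fun c N => by ring
  rw [e1]
  refine (exp_sum_le_sum_exp hne _).trans (Finset.sum_le_sum fun i _ => ?_)
  rw [Finset.card_univ, Fintype.card_fin, mul_add, mul_add]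
  refine (exp_add_add_le _ _ _).trans (le_of_eq ?_)
  rw [e2, e2, e2]

section Scaling

variable {α ρ τ x : ℝ} (hτ : 0 < τ) (hx : 0 < x)

include hτ hx in
lemma sq_mul_rpow_le (hρ : 0 < ρ) (hx1 : x ≤ 1) {c K : ℝ} (hc : 0 ≤ c) :
    (K * (2 * τ / τ ^ α) / x ^ (α - 1 - ρ / 2)) ^ 2 * (c * (τ * x) ^ (2 * α - 2)) ≤
      4 * K ^ 2 * c := by
  set q := τ ^ α with hq
  set w := x ^ (α - 1 - ρ / 2) with hw
  have hq0 : 0 < q := by positivity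
  have hw0 : 0 < w := by positivity
  have hw2 : w ^ 2 = x ^ (2 * α - 2 - ρ) := by
    rw [hw, ← Real.rpow_natCast, ← Real.rpow_mul hx.le]; congr 1; push_cast; ring
  have hq2 : q ^ 2 = τ ^ (2 * α) := by
    rw [hq, ← Real.rpow_natCast, ← Real.rpow_mul hτ.le]; congr 1; push_cast; ring
  have h1 : (τ * x) ^ (2 * α - 2) ≤ q ^ 2 * w ^ 2 / τ ^ 2 := by
    rw [hw2, hq2, Real.mul_rpow hτ.le hx.le]
    have : τ ^ (2 * α - 2) = τ ^ (2 * α) / τ ^ 2 := by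
      rw [Real.rpow_sub hτ]; norm_cast
    rw [this, mul_div_right_comm]
    gcongr ?_ * ?_
    exact Real.rpow_le_rpow_of_exponent_ge hx hx1 (by linarith)
  calc _ ≤ (K * (2 * τ / q) / w) ^ 2 * (c * (q ^ 2 * w ^ 2 / τ ^ 2)) := by gcongr
    _ = 4 * K ^ 2 * c := by field_simp; ring

include hτ hx in
lemma sq_mul_rpow_sub_eq {δ : ℝ} (hδ : 0 < δ) (c K : ℝ) :
    (K * (2 * τ / (δ ^ (ρ / 2) * τ ^ (α - ρ / 2))) / x ^ (α - 1 - ρ / 2)) ^ 2 *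
      (c * (2 * δ ^ ρ * (τ * x) ^ (2 * α - 2 - ρ))) = 8 * K ^ 2 * c := by
  set q := δ ^ (ρ / 2) * τ ^ (α - ρ / 2) with hq
  set w := x ^ (α - 1 - ρ / 2) with hw
  have hq0 : 0 < q := by positivity
  have hw0 : 0 < w := by positivity
  have hw2 : w ^ 2 = x ^ (2 * α - 2 - ρ) := by
    rw [hw, ← Real.rpow_natCast, ← Real.rpow_mul hx.le]; congr 1; push_cast; ring
  have hq2 : q ^ 2 = δ ^ ρ * τ ^ (2 * α - ρ) := by
    rw [hq, mul_pow, ← Real.rpow_natCast, ← Real.rpow_natCast, ← Real.rpow_mul hδ.le,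
      ← Real.rpow_mul hτ.le]
    congr 2 <;> (push_cast; ring)
  have h1 : δ ^ ρ * (τ * x) ^ (2 * α - 2 - ρ) = q ^ 2 * w ^ 2 / τ ^ 2 := by
    rw [hw2, hq2, Real.mul_rpow hτ.le hx.le]
    have : τ ^ (2 * α - 2 - ρ) = τ ^ (2 * α - ρ) / τ ^ 2 := by
      rw [show 2 * α - 2 - ρ = 2 * α - ρ - (2 : ℕ) by push_cast; ring,
        Real.rpow_sub_natCast hτ.ne']
    rw [this]
    ring
  rw [mul_assoc 2, h1]
  field_simp
  ring

end Scaling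

section Moments

variable {𝒰 : Type*} [MeasurableSpace 𝒰] {P : Measure 𝒰} {d : ℕ}
  {ξ : Fin d → ℕ × Fin 2 → 𝒰 → ℝ} (hm : ∀ i j, Measurable (ξ i j))
  (hg : ∀ i j, P.map (ξ i j) = gaussianReal 0 1) (hi : ∀ i, iIndepFun (ξ i) P)
  {α ρ : ℝ} (hα : 0 < α) (hα' : α < 1 / 2) (hρ : 0 < ρ) (hρ' : ρ < 2 * α)
  {s t : ℂ} (hs : 0 ≤ s.im) (ht : 0 ≤ t.im) (hst : 0 < ‖t - s‖) {ε η : ℝ} (hε : 0 < ε)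
  (hη : 0 < η) (hεη : 0 < |ε - η|)

include hm hg hi hα hα' hρ hρ' hs ht hst hε hη hεη in
/-- With `q = |t-s|^α` and `q' = |ε-η|^(ρ/2) |t-s|^(α-ρ/2)` the density along the arch is
`archWeight` times a quantity whose exponential moments are bounded uniformly in the point of the
arch, in `s`, `t` and in `ε`, `η`. -/
lemma lintegral_exp_archDensity_le (hd : 0 < d) {l : ℝ} (hl : 0 ≤ l) {r : ℝ}
    (hr : r ∈ Set.Ioo (0 : ℝ) 1) :
    ∫⁻ ω, ENNReal.ofReal (Real.exp (l * archDensity (fun i z => afbmField α (ξ i) ω z) s t ε η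
      (‖t - s‖ ^ α) (|ε - η| ^ (ρ / 2) * ‖t - s‖ ^ (α - ρ / 2)) r / archWeight α ρ r)) ∂P ≤
      d * (12 * ENNReal.ofReal (Real.exp (8 * (3 * (d * l)) ^ 2 * afbmConst α))) := by
  set q := ‖t - s‖ ^ α with hq
  set q' := |ε - η| ^ (ρ / 2) * ‖t - s‖ ^ (α - ρ / 2) with hq'
  set w := archWeight α ρ r with hw
  set z := arch s t r with hzdef
  set k := 3 * (d * l) * (2 * ‖t - s‖ / q) / w with hk
  set k' := 3 * (d * l) * (2 * ‖t - s‖ / q') / w with hk'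
  set E := ENNReal.ofReal (Real.exp (8 * (3 * (d * l)) ^ 2 * afbmConst α)) with hEdef
  have hx0 : 0 < r * (1 - r) := mul_pos hr.1 (sub_pos.2 hr.2)
  have hx1 : r * (1 - r) ≤ 1 := by nlinarith [sq_nonneg (r - 1), hr.1, hr.2]
  have hz : ‖t - s‖ * (r * (1 - r)) ≤ z.im := le_im_arch hs ht (Set.Ioo_subset_Icc_self hr)
  have hy : 0 < ‖t - s‖ * (r * (1 - r)) := mul_pos hst hx0
  have hκ := (afbmConst_pos hα hα').le
  have hw0 : 0 < w := archWeight_pos hr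
  have hk0 : 0 ≤ k := by positivity
  have hk'0 : 0 ≤ k' := by positivity
  have hv1 : k ^ 2 * (afbmConst α * (‖t - s‖ * (r * (1 - r))) ^ (2 * α - 2)) ≤
      8 * (3 * (d * l)) ^ 2 * afbmConst α := by
    rw [hk, hq, hw, archWeight]
    refine (sq_mul_rpow_le hst hx0 hρ hx1 hκ).trans ?_
    gcongr
    norm_num
  have hv2 : k' ^ 2 * (afbmConst α * (2 * |ε - η| ^ ρ *
      (‖t - s‖ * (r * (1 - r))) ^ (2 * α - 2 - ρ))) ≤ 8 * (3 * (d * l)) ^ 2 * afbmConst α := by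
    rw [hk', hq', hw, archWeight]
    exact (sq_mul_rpow_sub_eq hst hx0 hεη _ _).le
  have hE : (12 : ENNReal) * E = 4 * E + 4 * E + 4 * E := by ring
  have hmf : ∀ i (u : ℂ), Measurable fun ω => afbmField α (ξ i) ω u := fun i u =>
    measurable_afbmField (hm i) α measurable_id measurable_const
  have hm1 : ∀ i (u : ℂ), Measurable fun ω =>
      ENNReal.ofReal (Real.exp (k * ‖afbmField α (ξ i) ω u‖)) := fun i u =>
    ((hmf i u).norm.const_mul k).exp.ennreal_ofReal
  have hm2 : ∀ i (u v : ℂ), Measurable fun ω => ENNReal.ofReal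
      (Real.exp (k' * ‖afbmField α (ξ i) ω u - afbmField α (ξ i) ω v‖)) := fun i u v =>
    (((hmf i u).sub (hmf i v)).norm.const_mul k').exp.ennreal_ofReal
  calc _ ≤ ∫⁻ ω, ∑ i, (ENNReal.ofReal
        (Real.exp (k * ‖afbmField α (ξ i) ω (z + ε * Complex.I)‖)) +
        ENNReal.ofReal (Real.exp (k * ‖afbmField α (ξ i) ω (z + η * Complex.I)‖)) +
        ENNReal.ofReal (Real.exp (k' * ‖afbmField α (ξ i) ω (z + ε * Complex.I) -
          afbmField α (ξ i) ω (z + η * Complex.I)‖))) ∂P := by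
        refine lintegral_mono fun ω => ?_
        refine (ENNReal.ofReal_le_ofReal (exp_archDensity_le hd _ s t ε η q q' l w r)).trans ?_
        rw [ENNReal.ofReal_sum_of_nonneg fun _ _ => by positivity]
        refine Finset.sum_le_sum fun i _ => ?_
        rw [ENNReal.ofReal_add (by positivity) (by positivity),
          ENNReal.ofReal_add (by positivity) (by positivity)]
    _ = ∑ i, (∫⁻ ω, ENNReal.ofReal
        (Real.exp (k * ‖afbmField α (ξ i) ω (z + ε * Complex.I)‖)) ∂P +
        ∫⁻ ω, ENNReal.ofReal (Real.exp (k * ‖afbmField α (ξ i) ω (z + η * Complex.I)‖)) ∂P +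
        ∫⁻ ω, ENNReal.ofReal (Real.exp (k' * ‖afbmField α (ξ i) ω (z + ε * Complex.I) -
          afbmField α (ξ i) ω (z + η * Complex.I)‖)) ∂P) := by
        rw [lintegral_finsetSum _ fun i _ => by fun_prop]
        refine Finset.sum_congr rfl fun i _ => ?_
        rw [lintegral_add_right _ (hm2 i _ _), lintegral_add_left (hm1 i _)]
    _ ≤ ∑ i : Fin d, (12 * E) := by
        refine Finset.sum_le_sum fun i _ => ?_
        rw [hE]
        refine add_le_add (add_le_add ?_ ?_) ?_
        · refine (lintegral_exp_afbmField_le (hm i) (hg i) (hi i) hα hα' hk0 hy hz hε.le).trans ?_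
          gcongr
          exact ENNReal.ofReal_le_ofReal (Real.exp_le_exp.2 hv1)
        · refine (lintegral_exp_afbmField_le (hm i) (hg i) (hi i) hα hα' hk0 hy hz hη.le).trans ?_
          gcongr
          exact ENNReal.ofReal_le_ofReal (Real.exp_le_exp.2 hv1)
        · refine (lintegral_exp_afbmField_sub_le (hm i) (hg i) (hi i) hα hα' hk'0 hρ
            (by linarith) hy hz hε.le hη.le).trans ?_
          gcongr
          exact ENNReal.ofReal_le_ofReal (Real.exp_le_exp.2 hv2)
    _ = _ := by simp

end Moments

/-! ### Moments of the iterated integrals -/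

lemma measurable_iteratedFormIntegral {X : Type*} [MeasurableSpace X] (s : ℂ) :
    ∀ (n : ℕ) (G : Fin n → X → ℂ → ℂ), (∀ j, Measurable fun q : X × ℂ => G j q.1 q.2) →
      Measurable fun q : X × ℂ => iteratedFormIntegral n (fun j => G j q.1) s q.2
  | 0, _, _ => measurable_const
  | n + 1, G, hG => by
    have ih := measurable_iteratedFormIntegral s n (fun j => G j.succ) fun j => hG j.succ
    have hpt : Measurable fun x : (X × ℂ) × ℝ => s + (x.2 : ℂ) * (x.1.2 - s) := by fun_prop
    have hq : Measurable fun x : (X × ℂ) × ℝ => (x.1.1, s + (x.2 : ℂ) * (x.1.2 - s)) :=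
      (measurable_fst.comp measurable_fst).prodMk hpt
    have hsub : Measurable fun x : (X × ℂ) × ℝ => x.1.2 - s := by fun_prop
    have hF := hsub.mul (((hG 0).comp hq).mul (ih.comp hq))
    have := (hF.stronglyMeasurable.integral_prod_right'
      (ν := volume.restrict (Set.Ioc (0 : ℝ) 1))).measurable
    simp only [iteratedFormIntegral, segmentIntegral, intervalIntegral.integral_of_le zero_le_one]
    exact this

lemma afbmIterated_eq_iteratedFormIntegral {𝒰 : Type*} {d : ℕ} {Γ : Fin d → ℂ → 𝒰 → ℂ}
    {D : Fin d → ℂ → ℂ} {ω : 𝒰}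
    (h : ∀ i, ∀ z ∈ upperHalf, HasDerivAt (fun w => Γ i w ω) (D i z) z) {ε : ℝ} (hε : 0 < ε)
    {n : ℕ} (i : Fin n → Fin d) {s t : ℂ} (hs : 0 ≤ s.im) (ht : 0 ≤ t.im) :
    afbmIterated Γ ε i s t ω =
      iteratedFormIntegral n (fun j z => D (i j) (z + ε * Complex.I)) s t := by
  refine iteratedIntegral_eq_iteratedFormIntegral (U := {z | 0 ≤ z.im}) (convex_halfSpace_im_ge 0)
    hs n _ _ (fun j u hu => ?_) t ht
  have hu' : 0 ≤ u.im := hu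
  refine ((h (i j) (u + ε * Complex.I) ?_).comp_add_const u (ε * Complex.I)).deriv
  change 0 < (u + ε * Complex.I).im
  simp only [Complex.add_im, Complex.mul_im, Complex.ofReal_re, Complex.I_im, mul_one,
    Complex.ofReal_im, Complex.I_re, mul_zero, add_zero]
  linarith

lemma differentiableOn_of_hasDerivAt {f D : ℂ → ℂ}
    (h : ∀ z ∈ upperHalf, HasDerivAt f (D z) z) : DifferentiableOn ℂ D upperHalf := by
  have hf : DifferentiableOn ℂ f upperHalf := fun z hz =>
    (h z hz).differentiableAt.differentiableWithinAt
  exact (hf.deriv (isOpen_upper 0)).congr fun z hz => (h z hz).deriv.symm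

section Main

variable {𝒰 : Type*} [MeasurableSpace 𝒰] {P : Measure 𝒰} [IsProbabilityMeasure P] {d : ℕ}
  {ξ : Fin d → ℕ × Fin 2 → 𝒰 → ℝ} (hm : ∀ i j, Measurable (ξ i j))
  (hg : ∀ i j, P.map (ξ i j) = gaussianReal 0 1) (hi : ∀ i, iIndepFun (ξ i) P)
  {α ρ : ℝ} (hα : 0 < α) (hα' : α < 1 / 2) (hρ : 0 < ρ) (hρ' : ρ < 2 * α)
  {s t : ℂ} (hs : 0 ≤ s.im) (ht : 0 ≤ t.im) (hst : 0 < ‖t - s‖) {ε η : ℝ} (hε : 0 < ε)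
  (hη : 0 < η) (hεη : 0 < |ε - η|)
  (hhol : ∀ᵐ ω ∂P, ∀ i, DifferentiableOn ℂ (fun z => afbmField α (ξ i) ω z) upperHalf)

include hm in
lemma measurable_archDensity (s t : ℂ) (ε η q q' : ℝ) :
    Measurable fun x : 𝒰 × ℝ =>
      archDensity (fun i z => afbmField α (ξ i) x.1 z) s t ε η q q' x.2 := by
  have hD : ∀ i (a : ℝ), Measurable fun x : 𝒰 × ℝ =>
      afbmField α (ξ i) x.1 (arch s t x.2 + a * Complex.I) := fun i a =>
    measurable_afbmField (hm i) α measurable_fst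
      (((continuous_arch s t).measurable.comp measurable_snd).add_const _)
  unfold archDensity
  refine Finset.measurable_fun_sum _ fun i _ => ?_
  exact (((hD i ε).norm.const_mul _).add ((hD i η).norm.const_mul _)).add
    (((hD i ε).sub (hD i η)).norm.const_mul _)

include hm hg hi hα hα' hρ hρ' hs ht hst hε hη hεη hhol in
lemma lintegral_exp_integral_archDensity_le (hd : 0 < d) {c : ℝ} (hc : 0 ≤ c) :
    ∫⁻ ω, ENNReal.ofReal (Real.exp (c * ∫ r in (0 : ℝ)..1,
      archDensity (fun i z => afbmField α (ξ i) ω z) s t ε η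
      (‖t - s‖ ^ α) (|ε - η| ^ (ρ / 2) * ‖t - s‖ ^ (α - ρ / 2)) r)) ∂P ≤
      d * (12 * ENNReal.ofReal (Real.exp (8 * (3 * (d * ((∫ r in Set.Ioo (0 : ℝ) 1,
        archWeight α ρ r) * c))) ^ 2 * afbmConst α))) := by
  set q := ‖t - s‖ ^ α
  set q' := |ε - η| ^ (ρ / 2) * ‖t - s‖ ^ (α - ρ / 2)
  set J := ∫ r in Set.Ioo (0 : ℝ) 1, archWeight α ρ r with hJ
  set M : ENNReal := d * (12 * ENNReal.ofReal (Real.exp (8 * (3 * (d * (J * c))) ^ 2 *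
    afbmConst α)))
  have hJ0 : 0 < J := integral_archWeight_pos hρ'
  have hwI : Integrable (archWeight α ρ) (volume.restrict (Set.Ioo (0 : ℝ) 1)) :=
    integrableOn_archWeight hρ'
  have hwpos : ∀ᵐ r ∂(volume.restrict (Set.Ioo (0 : ℝ) 1)), 0 < archWeight α ρ r := by
    filter_upwards [ae_restrict_mem measurableSet_Ioo] with r hr using archWeight_pos hr
  have hmeas : Measurable fun x : 𝒰 × ℝ =>
      ENNReal.ofReal (Real.exp (J * c *
        archDensity (fun i z => afbmField α (ξ i) x.1 z) s t ε η q q' x.2 /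
          archWeight α ρ x.2)) * ENNReal.ofReal (archWeight α ρ x.2 / J) := by
    have h1 := measurable_archDensity hm (α := α) s t ε η q q'
    have h2 : Measurable fun x : 𝒰 × ℝ => archWeight α ρ x.2 :=
      (measurable_archWeight α ρ).comp measurable_snd
    exact ((h1.const_mul (J * c)).div h2).exp.ennreal_ofReal.mul (h2.div_const J).ennreal_ofReal
  calc _ ≤ ∫⁻ ω, (∫⁻ r in Set.Ioo (0 : ℝ) 1, ENNReal.ofReal (Real.exp (J * c *
        archDensity (fun i z => afbmField α (ξ i) ω z) s t ε η q q' r / archWeight α ρ r)) *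
        ENNReal.ofReal (archWeight α ρ r / J)) ∂P := by
        refine lintegral_mono_ae ?_
        filter_upwards [hhol] with ω hω
        have hint : Integrable
            (fun r => c * archDensity (fun i z => afbmField α (ξ i) ω z) s t ε η q q' r)
            (volume.restrict (Set.Ioo (0 : ℝ) 1)) :=
          (((continuousOn_archDensity hω hs ht hε hη q q').integrableOn_Icc).mono_set
            Set.Ioo_subset_Icc_self).const_mul c
        have := ofReal_exp_integral_le hwI hwpos hJ0 hint
        rw [← hJ, integral_const_mul, ← integral_Ioc_eq_integral_Ioo,
          ← intervalIntegral.integral_of_le zero_le_one] at this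
        simpa only [mul_assoc] using this
    _ = ∫⁻ r in Set.Ioo (0 : ℝ) 1, (∫⁻ ω, ENNReal.ofReal (Real.exp (J * c *
        archDensity (fun i z => afbmField α (ξ i) ω z) s t ε η q q' r / archWeight α ρ r)) *
        ENNReal.ofReal (archWeight α ρ r / J) ∂P) := lintegral_lintegral_swap hmeas.aemeasurable
    _ ≤ ∫⁻ r in Set.Ioo (0 : ℝ) 1, M * ENNReal.ofReal (archWeight α ρ r / J) := by
        refine lintegral_mono_ae ?_
        filter_upwards [ae_restrict_mem measurableSet_Ioo] with r hr
        rw [lintegral_mul_const' _ _ ENNReal.ofReal_ne_top]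
        gcongr
        exact lintegral_exp_archDensity_le hm hg hi hα hα' hρ hρ' hs ht hst hε hη hεη hd
          (by positivity) hr
    _ = M := by
        have hM : M ≠ ⊤ := ENNReal.mul_ne_top (ENNReal.natCast_ne_top d)
          (ENNReal.mul_ne_top (by simp) ENNReal.ofReal_ne_top)
        rw [lintegral_const_mul' _ _ hM, ← ofReal_integral_eq_lintegral_ofReal (hwI.div_const J)
          (hwpos.mono fun r hr => (div_pos hr hJ0).le), integral_div, ← hJ, div_self hJ0.ne']
        simp

include hm hg hi hα hα' hρ hρ' hs ht hst hε hη hεη hhol in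
lemma lintegral_norm_iteratedFormIntegral_sub_rpow_le {p : ℝ} (hp : 0 ≤ p) {m : ℕ}
    (i : Fin (m + 1) → Fin d) :
    ∫⁻ ω, ENNReal.ofReal (‖iteratedFormIntegral (m + 1)
          (fun j z => afbmField α (ξ (i j)) ω (z + ε * Complex.I)) s t -
        iteratedFormIntegral (m + 1)
          (fun j z => afbmField α (ξ (i j)) ω (z + η * Complex.I)) s t‖ ^ (2 * p)) ∂P ≤
      ENNReal.ofReal (|ε - η| ^ (p * ρ) * ‖t - s‖ ^ (p * (2 * (m + 1 : ℕ) * α - ρ))) *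
      (d * (12 * ENNReal.ofReal (Real.exp (8 * (3 * (d * ((∫ r in Set.Ioo (0 : ℝ) 1,
        archWeight α ρ r) * (2 * p)))) ^ 2 * afbmConst α)))) := by
  have hd : 0 < d := (i 0).pos
  refine le_trans ?_ (mul_le_mul_right (lintegral_exp_integral_archDensity_le hm hg hi hα hα' hρ
    hρ' hs ht hst hε hη hεη hhol hd (c := 2 * p) (by positivity)) _)
  rw [← lintegral_const_mul' _ _ ENNReal.ofReal_ne_top]
  refine lintegral_mono_ae ?_
  filter_upwards [hhol] with ω hω
  have h1 := norm_iteratedFormIntegral_shift_sub_le hω hs ht hε hη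
    (q := ‖t - s‖ ^ α) (q' := |ε - η| ^ (ρ / 2) * ‖t - s‖ ^ (α - ρ / 2))
    (by positivity) (by positivity) m i
  rw [← ENNReal.ofReal_mul (by positivity)]
  refine ENNReal.ofReal_le_ofReal ((Real.rpow_le_rpow (norm_nonneg _) h1
    (by positivity)).trans (le_of_eq ?_))
  rw [Real.mul_rpow (by positivity) (Real.exp_pos _).le, ← Real.exp_mul, mul_comm _ (2 * p)]
  congr 1
  have h2 : |ε - η| ^ (ρ / 2) * ‖t - s‖ ^ (α - ρ / 2) * (‖t - s‖ ^ α) ^ m =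
      |ε - η| ^ (ρ / 2) * ‖t - s‖ ^ (α - ρ / 2 + α * m) := by
    rw [Real.rpow_add hst, Real.rpow_mul hst.le, Real.rpow_natCast, mul_assoc]
  rw [h2, Real.mul_rpow (by positivity) (by positivity), ← Real.rpow_mul hεη.le,
    ← Real.rpow_mul hst.le]
  congr 2
  · ring
  · push_cast; ring

end Main

theorem mainTheorem6 (α : ℝ) (hα : 0 < α) (hα' : α < 1 / 2) (d : ℕ)
    (Ω : Set ℂ) (hΩ : Ω ⊆ closedUpperHalf) (hΩb : Bornology.IsBounded Ω)
    (hΩ0 : Ω ∈ 𝓝[closedUpperHalf] (0 : ℂ))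
    (p : ℝ) (hp : 1 ≤ p) (ρ : ℝ) (hρ : 0 < ρ) (hρ' : ρ < 2 * α) :
    ∃ C : ℝ, 0 < C ∧
      ∀ (𝒰 : Type u) [MeasurableSpace 𝒰] (P : Measure 𝒰) [IsProbabilityMeasure P]
        (Γ : Fin d → ℂ → 𝒰 → ℂ), IsAnalyticFBM α P Γ →
      ∀ n : ℕ, 3 ≤ n → ∀ i : Fin n → Fin d, ∀ ε η : ℝ, 0 < ε → 0 < η → ∀ s ∈ Ω, ∀ t ∈ Ω,
        Integrable
          (fun ω => ‖afbmIterated Γ ε i s t ω - afbmIterated Γ η i s t ω‖ ^ (2 * p)) P ∧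
        ∫ ω, ‖afbmIterated Γ ε i s t ω - afbmIterated Γ η i s t ω‖ ^ (2 * p) ∂P ≤
          C * |ε - η| ^ (p * ρ) * ‖t - s‖ ^ (p * (2 * n * α - ρ)) := by
  set M : ENNReal := d * (12 * ENNReal.ofReal (Real.exp (8 * (3 * (d * ((∫ r in Set.Ioo (0 : ℝ) 1,
        archWeight α ρ r) * (2 * p)))) ^ 2 * afbmConst α))) with hMdef
  have hM : M ≠ ⊤ := ENNReal.mul_ne_top (ENNReal.natCast_ne_top d)
    (ENNReal.mul_ne_top (by simp) ENNReal.ofReal_ne_top)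
  refine ⟨M.toReal + 1, by positivity, ?_⟩
  intro 𝒰 _ P _ Γ hΓ n hn i ε η hε hη s hsΩ t htΩ
  obtain ⟨m, rfl⟩ : ∃ m, n = m + 1 := ⟨n - 1, by omega⟩
  have hs : 0 ≤ s.im := hΩ hsΩ
  have ht : 0 ≤ t.im := hΩ htΩ
  have hp0 : 0 ≤ p := by linarith
  -- If `t = s` or `ε = η`, the two iterated integrals coincide; `|t - s|` and `|ε - η|` are
  -- positive from then on, so that one can divide by their powers.
  by_cases hdeg : t = s ∨ ε = η
  · have h0 : ∀ ω, afbmIterated Γ ε i s t ω - afbmIterated Γ η i s t ω = 0 := by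
      rcases hdeg with rfl | rfl
      · intro ω
        simp [afbmIterated, iteratedIntegral, segmentIntegral]
      · exact fun ω => sub_self _
    have h2p : 2 * p ≠ 0 := by linarith
    simp only [h0, norm_zero, Real.zero_rpow h2p, integral_zero]
    exact ⟨integrable_const 0, by positivity⟩
  push Not at hdeg
  have hst : 0 < ‖t - s‖ := norm_pos_iff.2 (sub_ne_zero.2 hdeg.1)
  have hεη : 0 < |ε - η| := abs_pos.2 (sub_ne_zero.2 hdeg.2)
  obtain ⟨ξ, hm, hg, hi, hae⟩ := hΓ
  set ζ : Fin d → ℕ × Fin 2 → 𝒰 → ℝ := fun i j => ξ (i, j) with hζ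
  have hiζ : ∀ i, iIndepFun (ζ i) P := fun i =>
    hi.precomp (g := fun j => (i, j)) (Prod.mk_right_injective i)
  have hder : ∀ᵐ ω ∂P, ∀ i, ∀ z ∈ upperHalf,
      HasDerivAt (fun w => Γ i w ω) (afbmField α (ζ i) ω z) z :=
    hae.mono fun ω h i z hz => (h i).1 z hz
  have hhol : ∀ᵐ ω ∂P, ∀ i, DifferentiableOn ℂ (fun z => afbmField α (ζ i) ω z) upperHalf :=
    hder.mono fun ω h i => differentiableOn_of_hasDerivAt (h i)
  set X : ℝ → 𝒰 → ℂ := fun a ω => iteratedFormIntegral (m + 1)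
    (fun j z => afbmField α (ζ (i j)) ω (z + a * Complex.I)) s t with hX
  have hXm : ∀ a, Measurable (X a) := fun a =>
    (measurable_iteratedFormIntegral s (m + 1)
      (fun j ω z => afbmField α (ζ (i j)) ω (z + a * Complex.I)) fun j =>
        measurable_afbmField (fun k => hm (i j, k)) α measurable_fst
          (measurable_snd.add_const _)).comp (measurable_id.prodMk measurable_const)
  have heq : (fun ω => ‖afbmIterated Γ ε i s t ω - afbmIterated Γ η i s t ω‖ ^ (2 * p)) =ᵐ[P]
      fun ω => ‖X ε ω - X η ω‖ ^ (2 * p) := by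
    filter_upwards [hder] with ω h
    rw [afbmIterated_eq_iteratedFormIntegral h hε i hs ht,
      afbmIterated_eq_iteratedFormIntegral h hη i hs ht]
  have hbound := lintegral_norm_iteratedFormIntegral_sub_rpow_le (fun i k => hm (i, k))
    (fun i k => hg (i, k)) hiζ hα hα' hρ hρ' hs ht hst hε hη hεη hhol hp0 i
  rw [← hMdef] at hbound
  set R := |ε - η| ^ (p * ρ) * ‖t - s‖ ^ (p * (2 * (m + 1 : ℕ) * α - ρ)) with hR
  have hR0 : 0 ≤ R := by positivity
  have hYm : Measurable fun ω => ‖X ε ω - X η ω‖ ^ (2 * p) :=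
    ((hXm ε).sub (hXm η)).norm.pow_const _
  have hY0 : ∀ ω, 0 ≤ ‖X ε ω - X η ω‖ ^ (2 * p) := fun ω => by positivity
  have hY : Integrable (fun ω => ‖X ε ω - X η ω‖ ^ (2 * p)) P := by
    refine ⟨hYm.aestronglyMeasurable, ?_⟩
    rw [hasFiniteIntegral_iff_ofReal (ae_of_all _ hY0)]
    exact hbound.trans_lt (ENNReal.mul_lt_top ENNReal.ofReal_lt_top hM.lt_top)
  refine ⟨hY.congr heq.symm, ?_⟩
  rw [integral_congr_ae heq,
    integral_eq_lintegral_of_nonneg_ae (ae_of_all _ hY0) hYm.aestronglyMeasurable]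
  have h1 := ENNReal.toReal_mono (ENNReal.mul_ne_top ENNReal.ofReal_ne_top hM) hbound
  rw [ENNReal.toReal_mul, ENNReal.toReal_ofReal hR0] at h1
  calc _ ≤ R * M.toReal := h1
    _ ≤ (M.toReal + 1) * R := by linarith
    _ = _ := by rw [hR]; ring
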